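/- Let $\mathbb T^3=(\mathbb R/2\pi\mathbb Z)^3$, write $\langle g\rangle=(2\pi)^{-3}\int_{\mathbb T^3}g\,dx$, and let $H=\{u\in L^2(\mathbb T^3;\mathbb R):\langle u\rangle=0\}$ and $A=-\Delta$ with domain $H^2(\mathbb T^3)\cap H$. Then $H$ has an orthonormal basis $(e_n)_{n\ge1}$ of eigenfunctions of $A$ with eigenvalues $0<\lambda_1\le\lambda_2\le\cdots$ (counted with multiplicity). Fix any such basis and put $\|u\|_{H^s}^2=\sum_n\lambda_n^s(u,e_n)^2$ and, for $N\in\mathbb N$ and $k>0$ with $\lambda_N>k$, $$R_{k,N}u=\sum_{n:\ \lambda_N-k\le\lambda_n\le\lambda_N+k}(u,e_n)e_n .$$ Let $f\in C^3(\mathbb R,\mathbb R)$ satisfy $|f(z)|+|f''(z)|\le K$ and $|f'(z)|\le L$ for all $z\in\mathbb R$, with constants $K,L$, and let $F:H\to H$, $F(u)=f(u)-\langle f(u)\rangle$. Then for every $\kappa\in(0,\tfrac12)$ the map $F$ satisfies the spatial averaging condition with exponent $\kappa$, gap constant $\rho=1$ and multiplier $a(u)=\langle f'(u)\rangle$. That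 is: (i) $F$ is globally bounded and globally Lipschitz continuous on $H$; (ii) $F$ has a Gateaux derivative $F'(u)\in\mathcal L(H,H)$ at every $u\in H$, and for all $u_1,u_2\in H$ $$F(u_1)-F(u_2)=l_{u_1,u_2}(u_1-u_2),\qquad l_{u_1,u_2}=\int_0^1F'(su_1+(1-s)u_2)\,ds\in\mathcal L(H,H)$$ (the integral being understood in the strong sense); (iii) $a:H\to\mathbb R$ is bounded and Borel measurable, and for all $\delta>0$, $R>0$, $k>0$ there are infinitely many $N\in\mathbb N$ such that $\lambda_N>k$, $\lambda_{N+1}-\lambda_N\ge1$, and $$\|R_{k,N}F'(u)R_{k,N}v-a(u)R_{k,N}v\|_H\le\delta\|v\|_H$$ for all $u\in H$ with $\|u\|_{H^{2-\kappa}}\le R$ and all $v\in H$. -/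

import Mathlib

open MeasureTheory Set
open scoped Real

noncomputable section

namespace CahnHilliard

/-! ### The abstract spatial averaging condition -/

section Abstract

variable {H : Type*} [NormedAddCommGroup H] [InnerProductSpace ℝ H]

/-- `‖u‖_{H^s} ≤ R` in the scale of spaces generated by the orthonormal basis `e` and the eigenvalues
`lam`, where `‖u‖_{H^s}² = ∑ λ_n^s (u, e_n)²` (the convergence of the series is part of the claim). -/
def SobolevNormLE (e : HilbertBasis ℕ ℝ H) (lam : ℕ → ℝ) (s R : ℝ) (u : H) : Prop :=
  Summable (fun n => lam n ^ s * inner ℝ (e n) u ^ 2) ∧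
    Real.sqrt (∑' n, lam n ^ s * inner ℝ (e n) u ^ 2) ≤ R

/-- The projector `R_{k,N} u = ∑_{n : λ_N - k ≤ λ_n ≤ λ_N + k} (u, e_n) e_n`. -/
def middleProj (e : HilbertBasis ℕ ℝ H) (lam : ℕ → ℝ) (k : ℝ) (N : ℕ) (u : H) : H :=
  ∑' n, {n | lam N - k ≤ lam n ∧ lam n ≤ lam N + k}.indicator
    (fun n => inner ℝ (e n) u • e n) n

/-- `F'` is the Gateaux derivative of `F`, and the integral mean value theorem
`F u₁ - F u₂ = l (u₁ - u₂)`, `l = ∫₀¹ F' (s u₁ + (1 - s) u₂) ds`, holds. The integral of operators is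
understood in the strong sense, i.e. `l v` is the Bochner integral of `F' (s u₁ + (1 - s) u₂) v`. -/
structure HasMeanValueDerivative [CompleteSpace H] (F : H → H) (F' : H → H →L[ℝ] H) : Prop where
  gateaux : ∀ u v, HasLineDerivAt ℝ F (F' u v) u v
  mean_value : ∀ u₁ u₂, ∃ l : H →L[ℝ] H,
    (∀ v, IntervalIntegrable (fun s : ℝ => F' (s • u₁ + (1 - s) • u₂) v) volume 0 1 ∧
      l v = ∫ s in (0 : ℝ)..1, F' (s • u₁ + (1 - s) • u₂) v) ∧
    F u₁ - F u₂ = l (u₁ - u₂)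

/-- The spatial averaging condition for `F`, with exponent `κ`, gap constant `ρ` and
multipliers `a N k δ : H → ℝ`. The basis `e` and the eigenvalues `lam` are numbered from `0`,
so that `lam N`, `e N` stand for the customary `λ_{N+1}`, `e_{N+1}`.
The requirement `k < lam N` is the one under which the projectors `R_{k,N}` are considered. -/
structure SpatialAveraging [CompleteSpace H] (e : HilbertBasis ℕ ℝ H) (lam : ℕ → ℝ)
    (F : H → H) (κ ρ : ℝ) (a : ℕ → ℝ → ℝ → H → ℝ) : Prop where
  exponent_pos : 0 < κ
  gap_pos : 0 < ρ
  bounded : ∃ C : ℝ, ∀ u, ‖F u‖ ≤ C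
  lipschitz : ∃ L : NNReal, LipschitzWith L F
  averaging : ∃ F' : H → H →L[ℝ] H, HasMeanValueDerivative F F' ∧
    ∀ δ > 0, ∀ R > 0, ∀ k > 0,
      {N : ℕ | k < lam N ∧ ρ ≤ lam (N + 1) - lam N ∧
        (∃ C : ℝ, ∀ u, |a N k δ u| ≤ C) ∧ Measurable[borel H] (a N k δ) ∧
        ∀ u, SobolevNormLE e lam (2 - κ) R u → ∀ v,
          ‖middleProj e lam k N (F' u (middleProj e lam k N v))
            - a N k δ u • middleProj e lam k N v‖ ≤ δ * ‖v‖}.Infinite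

end Abstract

/-! ### The Laplacian on the torus -/

instance : Fact (0 < 2 * π) := ⟨Real.two_pi_pos⟩

/-- The torus `(ℝ / 2πℤ)³`. -/
abbrev Torus : Type := Fin 3 → AddCircle (2 * π)

/-- The real space `L²(𝕋³)`. -/
abbrev L2 : Type := Lp ℝ 2 (volume : Measure Torus)

instance : IsFiniteMeasure (volume : Measure Torus) := by
  constructor
  rw [volume_pi, Measure.pi_univ]
  exact ENNReal.prod_lt_top (fun i _ => measure_lt_top _ _)

theorem integrable_L2 (u : L2) : Integrable (u : Torus → ℝ) :=
  (Lp.memLp u).integrable (by norm_num)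

/-- The space `H` of square integrable real functions on the torus with mean value zero. -/
def H : Submodule ℝ L2 where
  carrier := {u | ⨍ x, u x = 0}
  zero_mem' := by
    have h : (fun x => (0 : L2) x) =ᵐ[volume] fun _ : Torus => (0 : ℝ) := Lp.coeFn_zero _ _ _
    show ⨍ x, (0 : L2) x = 0
    rw [average_congr h]
    simp [average_eq]
  add_mem' := by
    intro u v hu hv
    have h : (fun x => (u + v : L2) x) =ᵐ[volume] fun x => u x + v x := Lp.coeFn_add u v
    simp only [mem_ofPred_eq, average_eq] at hu hv ⊢
    rw [integral_congr_ae h, integral_add (integrable_L2 u) (integrable_L2 v), smul_add, hu, hv,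
      add_zero]
  smul_mem' := by
    intro c u hu
    have h : (fun x => (c • u : L2) x) =ᵐ[volume] fun x => c • u x := Lp.coeFn_smul c u
    simp only [mem_ofPred_eq, average_eq] at hu ⊢
    rw [integral_congr_ae h, integral_smul, smul_comm, hu, smul_zero]

theorem isClosed_H : IsClosed (H : Set L2) := by
  have hc : Continuous fun u : L2 => ⨍ x, u x := by
    have h : (fun u : L2 => ∫ x, u x) = fun u : L2 =>
        inner ℝ (MemLp.toLp (fun _ : Torus => (1 : ℝ)) (memLp_const 1)) u := by
      funext u
      rw [L2.inner_def]
      refine integral_congr_ae ?_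
      filter_upwards [MemLp.coeFn_toLp (μ := (volume : Measure Torus)) (p := 2)
        (memLp_const (1 : ℝ))] with x hx
      simp [hx]
    have hi : Continuous fun u : L2 => ∫ x, u x := by
      rw [h]
      exact continuous_const.inner continuous_id
    simp only [average_eq]
    exact hi.const_smul ((volume : Measure Torus).real univ)⁻¹
  exact (isClosed_singleton (x := (0 : ℝ))).preimage hc

instance : CompleteSpace H := isClosed_H.completeSpace_coe

/-- The Fourier coefficient `u_l = (2π)⁻³ ∫ u(x) e^{-i l.x} dx`. -/
def fourierCoeff (u : H) (l : Fin 3 → ℤ) : ℂ :=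
  ⨍ x : Torus, ((u : L2) x : ℂ) * ∏ i, fourier (-(l i)) (x i)

/-- `u` lies in the domain `H²(𝕋³) ∩ {⟨u⟩ = 0}` of `A = -Δ`, and `A u = g`. On the Fourier side
`-Δ` is the multiplication by `|l|²`; as `g` is square integrable, `∑ |l|⁴ |u_l|² < ∞`. -/
def IsNegLaplacian (u g : H) : Prop :=
  ∀ l : Fin 3 → ℤ, fourierCoeff g l = ((∑ i, (l i) ^ 2 : ℤ) : ℂ) * fourierCoeff u l

/-- A complete orthonormal system in `H` of eigenfunctions of `A = -Δ`, numbered in the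
non-decreasing order of the eigenvalues (repeated according to multiplicity). -/
structure LaplaceEigensystem where
  e : HilbertBasis ℕ ℝ H
  lam : ℕ → ℝ
  lam_pos : ∀ n, 0 < lam n
  lam_mono : Monotone lam
  eigen : ∀ n, IsNegLaplacian (e n) (lam n • e n)

/-! ### The Cahn-Hilliard nonlinearity -/

/-- The assumptions on `f`: it is of class `C³`, `|f| + |f''| ≤ K` and `|f'| ≤ L`. -/
structure Admissible (f : ℝ → ℝ) (K L : ℝ) : Prop where
  contDiff : ContDiff ℝ 3 f
  bound : ∀ z, |f z| + |deriv (deriv f) z| ≤ K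
  bound_deriv : ∀ z, |deriv f z| ≤ L

theorem Admissible.memLp {f : ℝ → ℝ} {K L : ℝ} (hf : Admissible f K L) (u : L2) :
    MemLp (fun x => f (u x) - ⨍ y, f (u y)) 2 (volume : Measure Torus) := by
  have h : MemLp (fun x => f (u x)) 2 (volume : Measure Torus) :=
    MemLp.of_bound (hf.contDiff.continuous.comp_aestronglyMeasurable (Lp.aestronglyMeasurable u)) K
      (Filter.Eventually.of_forall fun x => by
        have := hf.bound (u x)
        have := abs_nonneg (deriv (deriv f) (u x))
        rw [Real.norm_eq_abs]
        linarith)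
  exact h.sub (memLp_const _)

theorem Admissible.mem_H {f : ℝ → ℝ} {K L : ℝ} (hf : Admissible f K L) (u : L2) :
    (hf.memLp u).toLp ∈ H := by
  have h1 : (fun x => (hf.memLp u).toLp (fun x => f (u x) - ⨍ y, f (u y)) x) =ᵐ[volume]
      fun x => f (u x) - ⨍ y, f (u y) := (hf.memLp u).coeFn_toLp
  show ⨍ x, (hf.memLp u).toLp (fun x => f (u x) - ⨍ y, f (u y)) x = 0
  rw [average_congr h1, average_eq, integral_sub_average, smul_zero]

/-- The nonlinearity `F(u)(x) = f(u(x)) - ⟨f(u)⟩`, as a map from `H` to `H`. -/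
def nonlinearity {f : ℝ → ℝ} {K L : ℝ} (hf : Admissible f K L) (u : H) : H :=
  ⟨(hf.memLp (u : L2)).toLp, hf.mem_H (u : L2)⟩

end CahnHilliard

end

noncomputable section

namespace CahnHilliard

/-! ### Lattice points in thin spherical shells -/

/-! In Fourier variables, multiplication by `f'(u)` restricted to the shell `λ_N - k ≤ |l|² ≤ λ_N +
k` has entries governed by the Fourier coefficients of `f'(u)` at combinations `a - b` of shell
frequencies. If `f'(u)` were a trigonometric polynomial with frequencies in a finite set `D`, and no
two lattice points of the shell differed by a nonzero element of `D`, only the mean of `f'(u)` would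
survive, and the averaging estimate would hold exactly.

Analysis supplies `D`. Since `2 - κ > 3/2`, a ball of `H^{2-κ}` is approximated uniformly, hence so
is its image under the Lipschitz function `f'`, by trigonometric polynomials whose frequency set
depends only on the ball and the accuracy (`exists_trig_approx`, `exists_trig_approx_comp`). The
uniform error `δ/2` costs at most `δ` in operator norm (`abs_inner_nonlinearityDeriv_sub_le`).

Arithmetic supplies the shells (`exists_sparse_shell`). If `a = b + m` and both points lie in the
shell, then `b·m = j` and `|b|² = |v|² + s` for one of finitely many triples `(m, j, s)`. By
Lagrange's identity `|m|²(|v|² + s) - j² = |b × m|²`, and `b × m` is orthogonal to `m`. For a prime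
`p` with `-|m|²` a nonresidue, the form `x² + y² + z²` is anisotropic mod `p` on the plane
orthogonal to `m`, so `p ∣ |b × m|²` forces `p² ∣ |b × m|²`. Choosing `v` mod `p²` so that `p`
divides the left side exactly once excludes the triple, and the Chinese remainder theorem handles
all triples together.

The real characters `cas` give an orthonormal basis indexed by single frequencies. The Sobolev norms
and the shell projectors are functions of the Laplacian, hence diagonal in this basis whatever
eigenbasis is given (`inner_hartley_of_inner_e`). Gaps of length 1 are automatic because the
eigenvalues are integers. The remaining claims follow from pointwise bounds on `f` and dominated
convergence. -/

open NumberTheorySymbols in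
-- Dirichlet's theorem gives a prime `p ≡ -1 mod 4a`. Then `-1` is a nonresidue since `p ≡ 3 mod 4`,
-- while by reciprocity the symbol of `a` depends only on `p mod 4a` and equals `J(a | 4a - 1) =
-- J(4a | 4a - 1) = 1`.
theorem exists_prime_not_isSquare_neg (a : ℕ) (ha : 0 < a) (n : ℕ) :
    ∃ p > n, p.Prime ∧ ¬ IsSquare ((-(a : ℤ) : ℤ) : ZMod p) := by
  have hc : (4 * a - 1).Coprime (4 * a) := by
    have := (Nat.coprime_self_add_right (m := 4 * a - 1) (n := 1)).2 (Nat.coprime_one_right _)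
    rwa [Nat.sub_add_cancel (by omega)] at this
  obtain ⟨p, hpn, hp, hmod⟩ := Nat.forall_exists_prime_gt_and_modEq n (q := 4 * a) (by omega) hc
  have := Fact.mk hp
  have hmod' : p % (4 * a) = 4 * a - 1 := by
    rw [hmod, Nat.mod_eq_of_lt (by omega)]
  have h4 : p % 4 = 3 := by
    have := Nat.mod_mod_of_dvd p (Dvd.intro a rfl : 4 ∣ 4 * a)
    rw [hmod'] at this
    omega
  have hodd : Odd p := Nat.odd_iff.2 (by omega)
  have hodd' : Odd (4 * a - 1) := Nat.odd_iff.2 (by omega)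
  refine ⟨p, hpn, hp, ?_⟩
  rw [← legendreSym.eq_neg_one_iff, jacobiSym.legendreSym.to_jacobiSym, jacobiSym.neg _ hodd,
    ZMod.χ₄_nat_three_mod_four h4, jacobiSym.mod_right' _ hodd, hmod']
  have h1 : J((4 : ℤ) * a | 4 * a - 1) = 1 := by
    have : (((4 : ℤ) * a) % ((4 * a - 1 : ℕ) : ℤ)) = 1 % ((4 * a - 1 : ℕ) : ℤ) := by
      refine (Int.emod_emod_of_dvd _ (dvd_refl _)).symm.trans ?_
      have : (4 : ℤ) * a = 1 + ((4 * a - 1 : ℕ) : ℤ) := by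
        push_cast [Nat.cast_sub (show 1 ≤ 4 * a by omega)]; ring
      rw [this]; simp
    rw [jacobiSym.mod_left, this, ← jacobiSym.mod_left, jacobiSym.one_left]
  have h2 : J((4 : ℤ) | 4 * a - 1) = 1 := by
    have : (4 : ℤ) = 2 ^ 2 := by norm_num
    rw [this]
    apply jacobiSym.sq_one'
    rw [Int.gcd_comm, Int.gcd_eq_natAbs]
    simpa using hodd'.coprime_two_right
  rw [jacobiSym.mul_left, h2, one_mul] at h1
  rw [h1]; norm_num

/-- The form `x² + y² + z²` restricted to the plane orthogonal to `(a, b, c)` has discriminant `a² +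
b² + c²` up to squares, so an isotropic vector there would make `-(a² + b² + c²)` a square. -/
theorem eq_zero_of_orthogonal_of_isotropic {F : Type*} [Field F] {a b c x y z : F}
    (hN : ¬ IsSquare (-(a ^ 2 + b ^ 2 + c ^ 2))) (h1 : a * x + b * y + c * z = 0)
    (h2 : x ^ 2 + y ^ 2 + z ^ 2 = 0) : x = 0 ∧ y = 0 ∧ z = 0 := by
  have key : ∀ a b c x y z : F, ¬ IsSquare (-(a ^ 2 + b ^ 2 + c ^ 2)) →
      a * x + b * y + c * z = 0 → x ^ 2 + y ^ 2 + z ^ 2 = 0 → c * y = 0 := by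
    intro a b c x y z hN h1 h2
    by_contra h
    -- Eliminating `z` leaves `(a² + c²)x² + 2abxy + (b² + c²)y² = 0`; completing the square gives
    -- `((a² + c²)x + aby)² = -(a² + b² + c²)(cy)²`.
    refine hN ⟨((a ^ 2 + c ^ 2) * x + a * b * y) / (c * y), ?_⟩
    rw [div_mul_div_comm, eq_div_iff (mul_ne_zero h h)]
    linear_combination (-(a ^ 2 + c ^ 2) * c ^ 2) * h2 -
      (a ^ 2 + c ^ 2) * (a * x + b * y - c * z) * h1
  -- Permuting the coordinates makes all products of entries with different indices vanish; a
  -- nonzero entry of `(a, b, c)` then kills two of `x, y, z`, and isotropy kills the third.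
  have p1 : c * y = 0 := key a b c x y z hN h1 h2
  have p2 : c * x = 0 := key b a c y x z (by convert hN using 3; ring)
    (by linear_combination h1) (by linear_combination h2)
  have p3 : b * z = 0 := key a c b x z y (by convert hN using 3; ring)
    (by linear_combination h1) (by linear_combination h2)
  have p4 : b * x = 0 := key c a b z x y (by convert hN using 3; ring)
    (by linear_combination h1) (by linear_combination h2)
  have p5 : a * y = 0 := key c b a z y x (by convert hN using 3; ring)
    (by linear_combination h1) (by linear_combination h2)
  have p6 : a * z = 0 := key b c a y z x (by convert hN using 3; ring)
    (by linear_combination h1) (by linear_combination h2)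
  by_cases hc : c = 0
  · by_cases hb : b = 0
    · have ha : a ≠ 0 := by
        rintro rfl
        exact hN ⟨0, by rw [hb, hc]; ring⟩
      have hy := (mul_eq_zero.1 p5).resolve_left ha
      have hz := (mul_eq_zero.1 p6).resolve_left ha
      refine ⟨?_, hy, hz⟩
      simpa [hy, hz] using h2
    · have hx := (mul_eq_zero.1 p4).resolve_left hb
      have hz := (mul_eq_zero.1 p3).resolve_left hb
      refine ⟨hx, ?_, hz⟩
      simpa [hx, hz] using h2
  · have hx := (mul_eq_zero.1 p2).resolve_left hc
    have hy := (mul_eq_zero.1 p1).resolve_left hc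
    refine ⟨hx, hy, ?_⟩
    simpa [hx, hy] using h2

theorem sq_dvd_of_orthogonal_of_dvd {p : ℕ} (hp : p.Prime) {a b c x y z : ℤ}
    (hN : ¬ IsSquare ((-(a ^ 2 + b ^ 2 + c ^ 2) : ℤ) : ZMod p))
    (h1 : a * x + b * y + c * z = 0) (h2 : (p : ℤ) ∣ x ^ 2 + y ^ 2 + z ^ 2) :
    (p : ℤ) ^ 2 ∣ x ^ 2 + y ^ 2 + z ^ 2 := by
  have := Fact.mk hp
  have h1' := congrArg (Int.cast : ℤ → ZMod p) h1
  have h2' := (ZMod.intCast_zmod_eq_zero_iff_dvd _ p).2 h2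
  push_cast at h1' h2' hN
  obtain ⟨hx, hy, hz⟩ := eq_zero_of_orthogonal_of_isotropic hN h1' h2'
  rw [ZMod.intCast_zmod_eq_zero_iff_dvd] at hx hy hz
  exact ((pow_dvd_pow_of_dvd hx 2).add (pow_dvd_pow_of_dvd hy 2)).add (pow_dvd_pow_of_dvd hz 2)

/-- The squared Euclidean length of a lattice vector. -/
def nsq (l : Fin 3 → ℤ) : ℤ := ∑ i, (l i) ^ 2

theorem nsq_nonneg (l : Fin 3 → ℤ) : 0 ≤ nsq l := Finset.sum_nonneg fun _ _ => sq_nonneg _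

theorem nsq_neg (l : Fin 3 → ℤ) : nsq (-l) = nsq l := by simp [nsq]

theorem sq_le_nsq (l : Fin 3 → ℤ) (i : Fin 3) : (l i) ^ 2 ≤ nsq l :=
  Finset.single_le_sum (f := fun i => (l i) ^ 2) (fun _ _ => sq_nonneg _) (Finset.mem_univ i)

theorem nsq_eq_zero {l : Fin 3 → ℤ} : nsq l = 0 ↔ l = 0 := by
  refine ⟨fun h => funext fun i => ?_, fun h => by simp [h, nsq]⟩
  have := sq_le_nsq l i
  exact pow_eq_zero_iff two_ne_zero |>.1 (le_antisymm (by rw [h] at this; exact this) (sq_nonneg _))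

theorem nsq_pos {l : Fin 3 → ℤ} (hl : l ≠ 0) : 0 < nsq l :=
  lt_of_le_of_ne (nsq_nonneg l) fun h => hl (nsq_eq_zero.1 h.symm)

/-- A solution mod `p` exists because every residue is a sum of two squares. It is arranged to be
nonsingular in the first coordinate, so that shifting this coordinate by `p` changes the value mod
`p²`. -/
theorem exists_exactly_dvd {p : ℕ} (hp : p.Prime) (hp2 : 2 < p) {N : ℤ} (hN : ¬ (p : ℤ) ∣ N)
    (j s : ℤ) : ∃ v : Fin 3 → ℤ, (p : ℤ) ∣ N * (nsq v + s) - j ^ 2 ∧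
      ¬ (p : ℤ) ^ 2 ∣ N * (nsq v + s) - j ^ 2 := by
  have := Fact.mk hp
  have hN' : (N : ZMod p) ≠ 0 := by rwa [Ne, ZMod.intCast_zmod_eq_zero_iff_dvd]
  -- One of `z = 0`, `z = 1` works. A nonzero target for `a² + b²` ensures that `a` or `b` is
  -- nonzero.
  obtain ⟨z, hz⟩ : ∃ z : ZMod p, (j : ZMod p) ^ 2 / N - s - z ^ 2 ≠ 0 := by
    by_contra! h
    have h0 := h 0
    have h1 := h 1
    have : (1 : ZMod p) = 0 := by linear_combination h0 - h1
    exact one_ne_zero this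
  have key : ∃ a b z : ZMod p, a ≠ 0 ∧ (N : ZMod p) * (a ^ 2 + b ^ 2 + z ^ 2 + s) - j ^ 2 = 0 := by
    obtain ⟨a, b, hab⟩ := ZMod.sq_add_sq p ((j : ZMod p) ^ 2 / N - s - z ^ 2)
    have h : (N : ZMod p) * (a ^ 2 + b ^ 2 + z ^ 2 + s) - j ^ 2 = 0 := by
      rw [hab]; field_simp; ring
    by_cases ha : a = 0
    · refine ⟨b, a, z, ?_, by linear_combination h⟩
      rintro rfl
      exact hz (by rw [← hab, ha]; ring)
    · exact ⟨a, b, z, ha, h⟩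
  obtain ⟨a, b, z, ha, h⟩ := key
  obtain ⟨a, rfl⟩ := ZMod.intCast_surjective a
  obtain ⟨b, rfl⟩ := ZMod.intCast_surjective b
  obtain ⟨z, rfl⟩ := ZMod.intCast_surjective z
  have ha' : ¬ (p : ℤ) ∣ a := by rwa [Ne, ZMod.intCast_zmod_eq_zero_iff_dvd] at ha
  have hd : (p : ℤ) ∣ N * (a ^ 2 + b ^ 2 + z ^ 2 + s) - j ^ 2 := by
    rw [← ZMod.intCast_zmod_eq_zero_iff_dvd]; push_cast; exact h
  by_cases hdd : (p : ℤ) ^ 2 ∣ N * (a ^ 2 + b ^ 2 + z ^ 2 + s) - j ^ 2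
  · refine ⟨![a + p, b, z], ?_, ?_⟩
    · have : N * (nsq ![a + p, b, z] + s) - j ^ 2 =
          N * (a ^ 2 + b ^ 2 + z ^ 2 + s) - j ^ 2 + p * (N * (2 * a + p)) := by
        simp [nsq, Fin.sum_univ_three]; ring
      rw [this]
      exact hd.add (dvd_mul_right _ _)
    · have : N * (nsq ![a + p, b, z] + s) - j ^ 2 =
          N * (a ^ 2 + b ^ 2 + z ^ 2 + s) - j ^ 2 + p ^ 2 * N + p * (N * (2 * a)) := by
        simp [nsq, Fin.sum_univ_three]; ring
      rw [this]
      intro hcon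
      have h3 := (Int.dvd_add_right (hdd.add (dvd_mul_right _ _))).1 hcon
      rw [pow_two] at h3
      have h4 := Int.dvd_of_mul_dvd_mul_left (by exact_mod_cast hp.ne_zero) h3
      have hpp := Nat.prime_iff_prime_int.1 hp
      rcases hpp.dvd_or_dvd h4 with h5 | h5
      · exact hN h5
      · rcases hpp.dvd_or_dvd h5 with h6 | h6
        · have := Int.le_of_dvd (by norm_num) h6
          omega
        · exact ha' h6
  · refine ⟨![a, b, z], ?_, ?_⟩ <;> simpa [nsq, Fin.sum_univ_three] using by assumption

/-- A triple `(m, j, s)` encodes the system `b·m = j`, `|b|² = |v|² + s`, which is to have no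
lattice solution `b`. Each triple is excluded by a condition on `v` modulo the square of its own
prime, and the conditions are combined by induction. -/
theorem exists_residue_avoiding (Q : Finset ((Fin 3 → ℤ) × ℤ × ℤ)) (hQ : ∀ t ∈ Q, t.1 ≠ 0) :
    ∃ q : ℕ, 0 < q ∧ ∃ w : Fin 3 → ℤ, ∀ v : Fin 3 → ℤ, (∀ i, (q : ℤ) ∣ v i - w i) →
      ∀ t ∈ Q, ∀ b : Fin 3 → ℤ, ∑ i, b i * t.1 i = t.2.1 → nsq b ≠ nsq v + t.2.2 := by
  classical
  induction Q using Finset.induction_on with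
  | empty => exact ⟨1, one_pos, 0, by simp⟩
  | insert t Q _ ih =>
    obtain ⟨q, hq, w, hw⟩ := ih fun t ht => hQ t (Finset.mem_insert_of_mem ht)
    obtain ⟨m, j, s⟩ := t
    have hm : m ≠ 0 := hQ _ (Finset.mem_insert_self _ _)
    have hNpos := nsq_pos hm
    -- Taking `p > q` makes `p` coprime to the modulus already used; `p > 2` is needed for
    -- `exists_exactly_dvd`.
    obtain ⟨p, hpq, hp, hns⟩ := exists_prime_not_isSquare_neg (nsq m).toNat (by omega)
      (max 2 q)
    rw [Int.toNat_of_nonneg hNpos.le] at hns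
    have hN : ¬ (p : ℤ) ∣ nsq m := by
      intro h
      apply hns
      have := (ZMod.intCast_zmod_eq_zero_iff_dvd (-nsq m) p).2 (dvd_neg.2 h)
      rw [this]
      exact ⟨0, by simp⟩
    obtain ⟨w', h1, h2⟩ := exists_exactly_dvd hp (by omega) hN j s
    have hcop : IsCoprime (q : ℤ) ((p : ℤ) ^ 2) := by
      apply IsCoprime.pow_right
      rw [Nat.isCoprime_iff_coprime, Nat.coprime_comm, hp.coprime_iff_not_dvd]
      intro h
      have := Nat.le_of_dvd hq h
      omega
    obtain ⟨x, y, hxy⟩ := hcop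
    -- Chinese remainder: with `x q + y p² = 1`, this vector is `w` mod `q` and `w'` mod `p²`.
    refine ⟨q * p ^ 2, Nat.mul_pos hq (pow_pos hp.pos 2),
      fun i => w i * (y * p ^ 2) + w' i * (x * q), fun v hv => ?_⟩
    have hvq : ∀ i, (q : ℤ) ∣ v i - w i := fun i => by
      obtain ⟨c, hc⟩ := hv i
      push_cast at hc
      exact ⟨p ^ 2 * c + (w' i - w i) * x, by linear_combination hc + w i * hxy⟩
    have hvp : ∀ i, (p : ℤ) ^ 2 ∣ v i - w' i := fun i => by
      obtain ⟨c, hc⟩ := hv i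
      push_cast at hc
      exact ⟨q * c + (w i - w' i) * y, by linear_combination hc + w' i * hxy⟩
    intro t ht
    rcases Finset.mem_insert.1 ht with rfl | ht
    swap
    · exact hw v hvq t ht
    intro b hb hbv
    simp only at hb hbv
    have hsq : (p : ℤ) ^ 2 ∣ nsq v - nsq w' := by
      rw [nsq, nsq, ← Finset.sum_sub_distrib]
      exact Finset.dvd_sum fun i _ => by
        rw [sq_sub_sq]; exact (hvp i).mul_left _
    have h3 : (p : ℤ) ^ 2 ∣ (nsq m * (nsq v + s) - j ^ 2) - (nsq m * (nsq w' + s) - j ^ 2) := by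
      have : (nsq m * (nsq v + s) - j ^ 2) - (nsq m * (nsq w' + s) - j ^ 2) =
        nsq m * (nsq v - nsq w') := by ring
      rw [this]; exact hsq.mul_left _
    have h4 : (p : ℤ) ∣ nsq m * (nsq v + s) - j ^ 2 := by
      have := ((dvd_pow_self (p : ℤ) two_ne_zero).trans h3).add h1
      simpa using this
    have h5 : ¬ (p : ℤ) ^ 2 ∣ nsq m * (nsq v + s) - j ^ 2 := by
      intro h
      apply h2
      have := h.sub h3
      simpa using this
    -- Lagrange's identity; the squares on the right are those of the coordinates of `b × m`.
    have hL : nsq m * (nsq v + s) - j ^ 2 = (b 1 * m 2 - b 2 * m 1) ^ 2 +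
        (b 2 * m 0 - b 0 * m 2) ^ 2 + (b 0 * m 1 - b 1 * m 0) ^ 2 := by
      rw [← hbv, ← hb]
      simp only [nsq, Fin.sum_univ_three]; ring
    rw [hL] at h4 h5
    refine h5 (sq_dvd_of_orthogonal_of_dvd hp (a := m 0) (b := m 1) (c := m 2) ?_ (by ring) h4)
    simpa [nsq, Fin.sum_univ_three] using hns

/-- There are arbitrarily large spheres through lattice points with a neighbourhood in which no two
lattice points differ by a vector from a given finite set. -/
theorem exists_sparse_shell (D : Finset (Fin 3 → ℤ)) (hD : (0 : Fin 3 → ℤ) ∉ D) (k : ℕ) (X : ℤ) :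
    ∃ v : Fin 3 → ℤ, X ≤ nsq v ∧ ∀ a b : Fin 3 → ℤ, |nsq a - nsq v| ≤ k → |nsq b - nsq v| ≤ k →
      a - b ∉ D := by
  classical
  set Jm : ℤ := ∑ m ∈ D, nsq m
  -- With `m = a - b`, the relation `|a|² = |b|² + 2 b·m + |m|²` bounds `2|b·m|` by `2k + |m|²`, and
  -- `|b|² - |v|²` lies in `[-k, k]`, so finitely many triples suffice.
  obtain ⟨q, hq, w, hw⟩ := exists_residue_avoiding
    (D ×ˢ (Finset.Icc (-(2 * k + Jm)) (2 * k + Jm) ×ˢ Finset.Icc (-(k : ℤ)) k))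
    (fun t ht h => hD (by rw [← h]; exact (Finset.mem_product.1 ht).1))
  refine ⟨fun i => w i + q * (|X| + |w i| + 1), ?_, fun a b ha hb hab => ?_⟩
  · refine le_trans ?_ (sq_le_nsq _ 0)
    have hq' : (1 : ℤ) ≤ q := by exact_mod_cast hq
    have h1 := le_abs_self X
    have h2 := neg_abs_le (w 0)
    have h3 := abs_nonneg X
    have h4 := abs_nonneg (w 0)
    have h5 : |X| + 1 ≤ w 0 + q * (|X| + |w 0| + 1) := by nlinarith
    nlinarith
  · refine hw (fun i => w i + q * (|X| + |w i| + 1)) (fun i => ⟨|X| + |w i| + 1, by ring⟩)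
      (a - b, ∑ i, b i * (a - b) i, nsq b - nsq (fun i => w i + q * (|X| + |w i| + 1)))
      ?_ b rfl (by simp)
    have hm : nsq (a - b) ≤ Jm := Finset.single_le_sum (fun m _ => nsq_nonneg m) hab
    have hm0 := nsq_nonneg (a - b)
    have e : nsq a = nsq b + 2 * ∑ i, b i * (a - b) i + nsq (a - b) := by
      simp only [nsq, Fin.sum_univ_three, Pi.sub_apply]; ring
    rw [abs_le] at ha hb
    simp only [Finset.mem_product, Finset.mem_Icc]
    refine ⟨hab, ⟨?_, ?_⟩, hb.1, hb.2⟩ <;> omega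

/-! ### Real trigonometric polynomials on the torus -/

/-- The character `x ↦ exp (i l·x)` of the torus. -/
def torusChar (l : Fin 3 → ℤ) : C(Torus, ℂ) where
  toFun x := ∏ i, fourier (l i) (x i)
  continuous_toFun := by fun_prop

theorem torusChar_apply (l : Fin 3 → ℤ) (x : Torus) :
    torusChar l x = ∏ i, fourier (l i) (x i) := rfl

theorem torusChar_neg (l : Fin 3 → ℤ) (x : Torus) :
    torusChar (-l) x = starRingEnd ℂ (torusChar l x) := by
  simp only [torusChar_apply, Pi.neg_apply, fourier_neg, map_prod]

theorem torusChar_add (l m : Fin 3 → ℤ) (x : Torus) :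
    torusChar (l + m) x = torusChar l x * torusChar m x := by
  simp only [torusChar_apply, Pi.add_apply, fourier_add, ← Finset.prod_mul_distrib]

theorem torusChar_zero (x : Torus) : torusChar 0 x = 1 := by
  simp [torusChar_apply]

theorem norm_torusChar (l : Fin 3 → ℤ) (x : Torus) : ‖torusChar l x‖ = 1 := by
  simp only [torusChar_apply, fourier_apply, norm_prod, Circle.norm_coe, Finset.prod_const_one]

theorem torusChar_single (x : Torus) (i : Fin 3) :
    torusChar (Pi.single i 1) x = fourier 1 (x i) := by
  rw [torusChar_apply, Finset.prod_eq_single i]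
  · simp
  · intro j _ hj
    simp [Pi.single_eq_of_ne hj]
  · simp

theorem integral_fourier_eq_zero {n : ℤ} (hn : n ≠ 0) :
    ∫ x : AddCircle (2 * π), (fourier n x : ℂ) = 0 := by
  rw [AddCircle.volume_eq_smul_haarAddCircle, integral_smul_measure]
  have := (orthonormal_iff_ite.mp (orthonormal_fourier (T := 2 * π))) 0 n
  rw [if_neg hn.symm, ContinuousMap.inner_toLp] at this
  simp only [← fourier_neg, ← fourier_add, neg_zero, add_zero] at this
  rw [this, smul_zero]

theorem integral_torusChar {l : Fin 3 → ℤ} (hl : l ≠ 0) : ∫ x : Torus, torusChar l x = 0 := by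
  simp only [torusChar_apply]
  rw [integral_fintype_prod_volume_eq_prod (fun i (y : AddCircle (2 * π)) => (fourier (l i) y : ℂ))]
  obtain ⟨i, hi⟩ := Function.ne_iff.mp hl
  exact Finset.prod_eq_zero (Finset.mem_univ i) (integral_fourier_eq_zero hi)

/-- The function `cas (l·x) = cos (l·x) + sin (l·x)` on the torus. -/
def cas (l : Fin 3 → ℤ) : C(Torus, ℝ) where
  toFun x := (torusChar l x).re + (torusChar l x).im
  continuous_toFun := by fun_prop

theorem cas_apply (l : Fin 3 → ℤ) (x : Torus) :
    cas l x = (torusChar l x).re + (torusChar l x).im := rfl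

theorem cas_neg_apply (l : Fin 3 → ℤ) (x : Torus) :
    cas (-l) x = (torusChar l x).re - (torusChar l x).im := by
  rw [cas_apply, torusChar_neg]; simp [sub_eq_add_neg]

theorem cas_zero : cas 0 = 1 := by
  ext x; simp [cas_apply, torusChar_zero]

theorem abs_cas_le (l : Fin 3 → ℤ) (x : Torus) : |cas l x| ≤ 2 := by
  rw [cas_apply]
  have h1 := Complex.abs_re_le_norm (torusChar l x)
  have h2 := Complex.abs_im_le_norm (torusChar l x)
  rw [norm_torusChar] at h1 h2
  exact (abs_add_le _ _).trans (by linarith)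

theorem norm_cas_le (l : Fin 3 → ℤ) : ‖cas l‖ ≤ 2 :=
  (ContinuousMap.norm_le _ zero_le_two).2 fun x => abs_cas_le l x

/-- This is `cas a · cas b = cos((a - b)·x) + sin((a + b)·x)` rewritten in `cas` alone, so that
products can be tracked through their frequencies. -/
theorem cas_mul_cas (a b : Fin 3 → ℤ) : cas a * cas b =
    (1 / 2 : ℝ) • (cas (a - b) + cas (b - a) + cas (a + b) - cas (-a - b)) := by
  ext x
  have h1 : b - a = -(a - b) := by abel
  have h2 : -a - b = -(a + b) := by abel
  rw [h1, h2]
  simp only [ContinuousMap.mul_apply, ContinuousMap.smul_apply, ContinuousMap.sub_apply,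
    ContinuousMap.add_apply, cas_neg_apply]
  simp only [cas_apply, sub_eq_add_neg, torusChar_add, torusChar_neg, Complex.mul_re,
    Complex.mul_im, Complex.conj_re, Complex.conj_im, smul_eq_mul]
  ring

theorem integral_cas {l : Fin 3 → ℤ} (hl : l ≠ 0) : ∫ x : Torus, cas l x = 0 := by
  have hi : Integrable (fun x : Torus => torusChar l x) :=
    (torusChar l).continuous.integrable_of_hasCompactSupport (HasCompactSupport.of_compactSpace _)
  have h := integral_torusChar hl
  simp only [cas_apply]
  have h0 := integral_add hi.re hi.im
  simp only [RCLike.re_to_complex, RCLike.im_to_complex] at h0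
  rw [h0]
  have h1 := integral_re hi
  have h2 := integral_im hi
  rw [h] at h1 h2
  simp only [RCLike.re_to_complex, RCLike.im_to_complex, Complex.zero_re, Complex.zero_im] at h1 h2
  rw [h1, h2, add_zero]

/-- Real trigonometric polynomials with frequencies in `S`. -/
def trigSpan (S : Set (Fin 3 → ℤ)) : Submodule ℝ C(Torus, ℝ) := Submodule.span ℝ (cas '' S)

theorem cas_mem_trigSpan {S : Set (Fin 3 → ℤ)} {l : Fin 3 → ℤ} (hl : l ∈ S) : cas l ∈ trigSpan S :=
  Submodule.subset_span ⟨l, hl, rfl⟩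

theorem trigSpan_mono {S S' : Set (Fin 3 → ℤ)} (h : S ⊆ S') : trigSpan S ≤ trigSpan S' :=
  Submodule.span_mono (image_mono h)

theorem mul_mem_trigSpan {S S' U : Set (Fin 3 → ℤ)} {f g : C(Torus, ℝ)} (hf : f ∈ trigSpan S)
    (hg : g ∈ trigSpan S') (hU : ∀ a ∈ S, ∀ b ∈ S', a - b ∈ U ∧ b - a ∈ U ∧ a + b ∈ U ∧ -a - b ∈ U) :
    f * g ∈ trigSpan U := by
  induction hf using Submodule.span_induction with
  | mem f hf =>
    obtain ⟨a, ha, rfl⟩ := hf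
    induction hg using Submodule.span_induction with
    | mem g hg =>
      obtain ⟨b, hb, rfl⟩ := hg
      obtain ⟨h1, h2, h3, h4⟩ := hU a ha b hb
      rw [cas_mul_cas]
      exact Submodule.smul_mem _ _ (Submodule.sub_mem _ (Submodule.add_mem _ (Submodule.add_mem _
        (cas_mem_trigSpan h1) (cas_mem_trigSpan h2)) (cas_mem_trigSpan h3)) (cas_mem_trigSpan h4))
    | zero => simp
    | add g g' _ _ h h' => rw [mul_add]; exact Submodule.add_mem _ h h'
    | smul c g _ h => rw [mul_smul_comm]; exact Submodule.smul_mem _ _ h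
  | zero => simp
  | add g g' _ _ h h' => rw [add_mul]; exact Submodule.add_mem _ h h'
  | smul c g _ h => rw [smul_mul_assoc]; exact Submodule.smul_mem _ _ h

theorem _root_.ContinuousMap.integrable_torus (f : C(Torus, ℝ)) : Integrable (fun x => f x) :=
  f.continuous.integrable_of_hasCompactSupport (HasCompactSupport.of_compactSpace _)

theorem integral_eq_zero_of_mem_trigSpan {S : Set (Fin 3 → ℤ)} (hS : (0 : Fin 3 → ℤ) ∉ S)
    {f : C(Torus, ℝ)} (hf : f ∈ trigSpan S) : ∫ x, f x = 0 := by
  induction hf using Submodule.span_induction with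
  | mem f hf =>
    obtain ⟨a, ha, rfl⟩ := hf
    exact integral_cas fun h => hS (h ▸ ha)
  | zero => simp
  | add g g' _ _ h h' =>
    simp only [ContinuousMap.add_apply]
    rw [integral_add g.integrable_torus g'.integrable_torus, h, h', add_zero]
  | smul c g _ h =>
    simp only [ContinuousMap.smul_apply]
    rw [integral_smul, h, smul_zero]

/-- The algebra of all real trigonometric polynomials. -/
def trigAlgebra : Subalgebra ℝ C(Torus, ℝ) :=
  (trigSpan univ).toSubalgebra (cas_zero ▸ cas_mem_trigSpan (mem_univ 0))
    fun _ _ hf hg => mul_mem_trigSpan hf hg fun _ _ _ _ => ⟨trivial, trivial, trivial, trivial⟩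

theorem trigAlgebra_separatesPoints : trigAlgebra.SeparatesPoints := by
  intro x y hxy
  obtain ⟨i, hi⟩ := Function.ne_iff.mp hxy
  by_contra! h
  have h' : ∀ l, cas l x = cas l y := fun l =>
    h _ ⟨cas l, cas_mem_trigSpan (mem_univ l), rfl⟩
  have h1 := h' (Pi.single i 1)
  have h2 := h' (-Pi.single i 1)
  rw [cas_neg_apply, cas_neg_apply] at h2
  rw [cas_apply, cas_apply] at h1
  have h3 : torusChar (Pi.single i 1) x = torusChar (Pi.single i 1) y :=
    Complex.ext (by linarith) (by linarith)
  rw [torusChar_single, torusChar_single, fourier_one, fourier_one] at h3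
  exact hi (AddCircle.injective_toCircle Real.two_pi_pos.ne' (Circle.coe_injective h3))

theorem trigSpan_univ_topologicalClosure : (trigSpan univ).topologicalClosure = ⊤ :=
  congrArg Subalgebra.toSubmodule
    (ContinuousMap.subalgebra_topologicalClosure_eq_top_of_separatesPoints trigAlgebra
      trigAlgebra_separatesPoints)

/-- The class of a continuous function in `L²(𝕋³)`. -/
abbrev contToL2 : C(Torus, ℝ) →L[ℝ] L2 := ContinuousMap.toLp 2 volume ℝ

theorem inner_contToL2 (f : C(Torus, ℝ)) (u : L2) :
    inner ℝ (contToL2 f) u = ∫ x, f x * u x := by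
  rw [L2.inner_def]
  refine integral_congr_ae ?_
  filter_upwards [ContinuousMap.coeFn_toLp (p := 2) (𝕜 := ℝ) volume f] with x hx
  rw [hx]; simp [mul_comm]

/-- By Stone–Weierstrass the span of the `cas` functions is uniformly dense in the continuous
functions, hence dense in `L²`. -/
theorem eq_zero_of_forall_inner_cas_eq_zero {u : L2}
    (h : ∀ l, inner ℝ (contToL2 (cas l)) u = 0) : u = 0 := by
  have hd := (ContinuousMap.toLp_denseRange ℝ (volume : Measure Torus) ℝ
    (p := 2) (by norm_num)).topologicalClosure_map_submodule trigSpan_univ_topologicalClosure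
  rw [Submodule.topologicalClosure_eq_top_iff] at hd
  have : u ∈ ((trigSpan univ).map (contToL2 : C(Torus, ℝ) →ₗ[ℝ] L2))ᗮ := by
    rw [trigSpan, Submodule.map_span, Submodule.mem_orthogonal]
    intro v hv
    induction hv using Submodule.span_induction with
    | mem v hv =>
      obtain ⟨_, ⟨l, _, rfl⟩, rfl⟩ := hv
      exact h l
    | zero => simp
    | add v w _ _ h h' => rw [inner_add_left, h, h', add_zero]
    | smul c v _ h => rw [inner_smul_left, h, mul_zero]
  exact (Submodule.mem_bot ℝ).1 (hd ▸ this)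

/-! ### The Hartley basis of `H` -/

theorem volume_torus_pos : 0 < (volume : Measure Torus).real univ := by
  rw [measureReal_def, ENNReal.toReal_pos_iff]
  refine ⟨?_, measure_lt_top _ _⟩
  rw [volume_pi, Measure.pi_univ, pos_iff_ne_zero, Finset.prod_ne_zero_iff]
  intro i _
  rw [AddCircle.measure_univ]
  simp [Real.pi_pos]

theorem average_torus {E : Type*} [NormedAddCommGroup E] [NormedSpace ℝ E] (g : Torus → E) :
    ⨍ x, g x = ((volume : Measure Torus).real univ)⁻¹ • ∫ x, g x := average_eq _ _

theorem mem_H_iff {u : L2} : u ∈ H ↔ ∫ x, u x = 0 := by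
  change ⨍ x, u x = 0 ↔ _
  rw [average_torus, smul_eq_zero]
  exact or_iff_right (inv_ne_zero volume_torus_pos.ne')

/-- The pairing of an element of `H` with `cas (l·x)`. -/
def casCoeff (l : Fin 3 → ℤ) (u : H) : ℝ := inner ℝ (contToL2 (cas l)) (u : L2)

theorem casCoeff_eq_integral (l : Fin 3 → ℤ) (u : H) :
    casCoeff l u = ∫ x, cas l x * (u : L2) x := inner_contToL2 _ _

theorem casCoeff_zero (u : H) : casCoeff 0 u = 0 := by
  rw [casCoeff_eq_integral, cas_zero]
  simpa using mem_H_iff.1 u.2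

theorem casCoeff_smul (l : Fin 3 → ℤ) (c : ℝ) (u : H) : casCoeff l (c • u) = c * casCoeff l u := by
  simp [casCoeff, inner_smul_right]

/-- Even and odd parts in `l` of the real coefficient give the real and imaginary parts of the
complex one. As `|l|² = |-l|²`, the eigenvalue equation transfers to `casCoeff`. -/
theorem fourierCoeff_eq (u : H) (l : Fin 3 → ℤ) :
    fourierCoeff u l = (((volume : Measure Torus).real univ)⁻¹ : ℝ) •
      (((casCoeff l u + casCoeff (-l) u) / 2 : ℝ) -
        ((casCoeff l u - casCoeff (-l) u) / 2 : ℝ) * Complex.I) := by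
  have hi : ∀ l, Integrable fun x => cas l x * (u : L2) x := fun l =>
    (integrable_L2 u).bdd_mul (c := 2) (cas l).continuous.aestronglyMeasurable
      (Filter.Eventually.of_forall fun x => abs_cas_le l x)
  have h : ∀ x : Torus, ((u : L2) x : ℂ) * ∏ i, fourier (-(l i)) (x i) =
      (((cas l x * (u : L2) x + cas (-l) x * (u : L2) x) / 2 : ℝ) : ℂ) -
        (((cas l x * (u : L2) x - cas (-l) x * (u : L2) x) / 2 : ℝ) : ℂ) * Complex.I := by
    intro x
    have : ∏ i, (fourier (-(l i)) (x i) : ℂ) = torusChar (-l) x := rfl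
    rw [this, torusChar_neg, cas_neg_apply, cas_apply]
    apply Complex.ext <;> simp <;> ring
  rw [fourierCoeff, average_torus]
  congr 1
  simp only [h]
  rw [integral_sub, integral_mul_const, integral_complex_ofReal, integral_complex_ofReal,
    integral_div, integral_div, integral_add (hi _) (hi _), integral_sub (hi _) (hi _)]
  · simp only [casCoeff_eq_integral]
  · exact (((hi _).add (hi _)).div_const 2).ofReal
  · exact (((hi _).sub (hi _)).div_const 2).ofReal.mul_const _

theorem isNegLaplacian_iff (u g : H) :
    IsNegLaplacian u g ↔ ∀ l, casCoeff l g = (nsq l : ℝ) * casCoeff l u := by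
  have hv := volume_torus_pos
  have hc : ∀ l : Fin 3 → ℤ, ((∑ i, (l i) ^ 2 : ℤ) : ℂ) = ((nsq l : ℝ) : ℂ) := fun l => by
    simp [nsq]
  constructor
  · intro h l
    have h1 := h l
    rw [fourierCoeff_eq, fourierCoeff_eq, mul_smul_comm, hc] at h1
    have h1 := smul_right_injective ℂ (inv_ne_zero hv.ne') h1
    have hre := congrArg Complex.re h1
    have him := congrArg Complex.im h1
    simp at hre him
    linarith
  · intro h l
    rw [fourierCoeff_eq, fourierCoeff_eq, mul_smul_comm, h l, h (-l), nsq_neg, hc]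
    congr 1
    apply Complex.ext <;> simp <;> ring

theorem eq_zero_of_forall_casCoeff_eq_zero {u : H} (h : ∀ l, l ≠ 0 → casCoeff l u = 0) : u = 0 := by
  refine Subtype.ext (eq_zero_of_forall_inner_cas_eq_zero fun l => ?_)
  by_cases hl : l = 0
  · rw [hl]; exact casCoeff_zero u
  · exact h l hl

/-- The index set of the Hartley basis. -/
abbrev Freq : Type := {l : Fin 3 → ℤ // l ≠ 0}

/-- The normalising constant of the Hartley basis. -/
def casNorm : ℝ := (Real.sqrt ((volume : Measure Torus).real univ))⁻¹

theorem casNorm_pos : 0 < casNorm := inv_pos.2 (Real.sqrt_pos.2 volume_torus_pos)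

theorem casNorm_sq : casNorm * casNorm * (volume : Measure Torus).real univ = 1 := by
  rw [casNorm, ← mul_inv, Real.mul_self_sqrt volume_torus_pos.le,
    inv_mul_cancel₀ volume_torus_pos.ne']

theorem contToL2_mem_H {f : C(Torus, ℝ)} (hf : ∫ x, f x = 0) : contToL2 f ∈ H := by
  rw [mem_H_iff, integral_congr_ae (ContinuousMap.coeFn_toLp volume f), hf]

/-- The normalised functions `cas (l·x)`. -/
def hartley (l : Freq) : H := casNorm • ⟨contToL2 (cas l), contToL2_mem_H (integral_cas l.2)⟩

theorem inner_hartley (l : Freq) (u : H) :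
    inner ℝ (hartley l) u = casNorm * casCoeff l u := by
  change inner ℝ (casNorm • contToL2 (cas l)) (u : L2) = _
  rw [real_inner_smul_left]; rfl

theorem integral_cas_mul_cas (l m : Fin 3 → ℤ) :
    ∫ x, cas l x * cas m x = if l = m then (volume : Measure Torus).real univ else 0 := by
  have e : ∀ x, cas l x * cas m x = (1 / 2) *
      (cas (l - m) x + cas (m - l) x + cas (l + m) x - cas (-l - m) x) := fun x => by
    have := congrArg (fun f : C(Torus, ℝ) => f x) (cas_mul_cas l m)
    simpa using this
  have hi : ∀ a, Integrable fun x => cas a x := fun a => (cas a).integrable_torus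
  have h1 : ∫ x, (cas (l + m) x - cas (-l - m) x) = 0 := by
    by_cases h : l + m = 0
    · have : -l - m = 0 := by rw [← neg_add', h, neg_zero]
      simp [h, this]
    · have h' : -l - m ≠ 0 := by rwa [← neg_add', neg_ne_zero]
      rw [integral_sub (hi _) (hi _), integral_cas h, integral_cas h', sub_zero]
  simp only [e, add_sub_assoc]
  have h2 := integral_add ((hi (l - m)).add (hi (m - l))) ((hi (l + m)).sub (hi (-l - m)))
  simp only [Pi.add_apply, Pi.sub_apply] at h2
  rw [integral_const_mul, h2, h1, integral_add (hi _) (hi _)]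
  split_ifs with h
  · simp [h, cas_zero]; ring
  · rw [integral_cas (sub_ne_zero.2 h), integral_cas (sub_ne_zero.2 (Ne.symm h))]; simp

theorem casCoeff_hartley (l : Freq) (m : Fin 3 → ℤ) :
    casCoeff m (hartley l) = if (l : Fin 3 → ℤ) = m then casNorm⁻¹ else 0 := by
  rw [hartley, casCoeff_smul]
  have : casCoeff m ⟨contToL2 (cas l), contToL2_mem_H (integral_cas l.2)⟩ =
      ∫ x, cas l x * cas m x := by
    rw [casCoeff, real_inner_comm, inner_contToL2]
    refine integral_congr_ae ?_
    filter_upwards [ContinuousMap.coeFn_toLp (p := 2) (𝕜 := ℝ) volume (cas m)] with x hx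
    rw [hx]
  rw [this, integral_cas_mul_cas]
  split_ifs
  · rw [← mul_one casNorm⁻¹, ← casNorm_sq]
    field_simp [casNorm_pos.ne']
  · simp

theorem orthonormal_hartley : Orthonormal ℝ hartley := by
  classical
  rw [orthonormal_iff_ite]
  intro l m
  rw [inner_hartley, casCoeff_hartley]
  by_cases h : l = m
  · simp [h, casNorm_pos.ne']
  · rw [if_neg h, if_neg fun h' => h (Subtype.ext h'.symm), mul_zero]

theorem orthogonal_span_hartley : (Submodule.span ℝ (range hartley))ᗮ = ⊥ := by
  rw [eq_bot_iff]
  intro u hu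
  rw [Submodule.mem_orthogonal] at hu
  refine (Submodule.mem_bot ℝ).2 (eq_zero_of_forall_casCoeff_eq_zero fun l hl => ?_)
  have := hu (hartley ⟨l, hl⟩) (Submodule.subset_span ⟨_, rfl⟩)
  rw [inner_hartley] at this
  exact (mul_eq_zero.1 this).resolve_left casNorm_pos.ne'

/-- The Hilbert basis of `H` consisting of the normalised functions `cas (l·x)`. -/
def hartleyBasis : HilbertBasis Freq ℝ H :=
  HilbertBasis.mkOfOrthogonalEqBot orthonormal_hartley orthogonal_span_hartley

theorem coe_hartleyBasis : ⇑hartleyBasis = hartley := HilbertBasis.coe_mkOfOrthogonalEqBot _ _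

/-! ### Existence of an ordered eigenbasis -/

/-- Ties of `φ` are broken by an encoding. The number of strict predecessors is then an injective
rank whose infinite range in `ℕ` is enumerated increasingly. -/
theorem exists_equiv_nat_monotone {ι : Type*} [Infinite ι] [Encodable ι] (φ : ι → ℤ)
    (hfin : ∀ n, {i | φ i ≤ n}.Finite) : ∃ σ : ℕ ≃ ι, Monotone fun n => φ (σ n) := by
  classical
  let key : ι → ℤ ×ₗ ℕ := fun i => toLex (φ i, Encodable.encode i)
  have hkey : Function.Injective key := fun i j h =>
    Encodable.encode_injective (Prod.ext_iff.1 (toLex_inj.1 h)).2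
  have hfin' : ∀ i, {j | key j < key i}.Finite := fun i =>
    (hfin (φ i)).subset fun j hj => by
      rcases Prod.Lex.toLex_lt_toLex.1 hj with h | h
      · exact le_of_lt h
      · exact le_of_eq h.1
  let rank : ι → ℕ := fun i => {j | key j < key i}.ncard
  have hrank : ∀ i j, key i < key j → rank i < rank j := fun i j h =>
    ncard_lt_ncard ⟨fun a (ha : key a < key i) => ha.trans h,
      fun hsub => lt_irrefl (key i) (hsub (show i ∈ {a | key a < key j} from h))⟩ (hfin' j)
  have hinj : Function.Injective rank := fun i j h => by
    rcases lt_trichotomy (key i) (key j) with h' | h' | h'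
    · exact absurd h (hrank _ _ h').ne
    · exact hkey h'
    · exact absurd h (hrank _ _ h').ne'
  have hmono : ∀ i j, rank i ≤ rank j → φ i ≤ φ j := fun i j h => by
    by_contra! hlt
    exact absurd (hrank j i (Prod.Lex.toLex_lt_toLex.2 (Or.inl hlt))) (not_lt.2 h)
  have : Infinite (range rank) := infinite_coe_iff.2 (infinite_range_of_injective hinj)
  let o := Nat.Subtype.orderIsoOfNat (range rank)
  refine ⟨o.toEquiv.trans (Equiv.ofInjective rank hinj).symm, fun m n hmn => hmono _ _ ?_⟩
  have h : ∀ n, rank ((o.toEquiv.trans (Equiv.ofInjective rank hinj).symm) n) = o n := fun n => by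
    exact congrArg Subtype.val ((Equiv.ofInjective rank hinj).apply_symm_apply (o n))
  rw [h, h]
  exact o.monotone hmn

theorem finite_nsq_le (n : ℤ) : {l : Fin 3 → ℤ | nsq l ≤ n}.Finite := by
  refine (Set.Finite.pi fun _ : Fin 3 => Set.finite_Icc (-n) n).subset fun l hl i _ => ?_
  have h := (sq_le_nsq l i).trans hl
  constructor <;> nlinarith

theorem finite_freq_nsq_le (n : ℤ) : {l : Freq | nsq l ≤ n}.Finite :=
  Set.Finite.preimage (f := Subtype.val) Subtype.val_injective.injOn (finite_nsq_le n)

instance : Infinite Freq := by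
  refine Infinite.of_injective (fun n : ℕ => (⟨fun _ => n + 1, fun h => ?_⟩ : Freq)) fun m n h => ?_
  · have := congrFun h 0
    simp at this
    omega
  · have := congrFun (congrArg Subtype.val h) 0
    simpa using this

theorem nonempty_laplaceEigensystem : Nonempty LaplaceEigensystem := by
  have : Encodable Freq := Encodable.ofCountable _
  obtain ⟨σ, hσ⟩ := exists_equiv_nat_monotone (fun l : Freq => nsq l) finite_freq_nsq_le
  have hspan : (Submodule.span ℝ (range (hartley ∘ σ)))ᗮ = ⊥ := by
    rw [σ.surjective.range_comp, orthogonal_span_hartley]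
  exact ⟨{
    e := HilbertBasis.mkOfOrthogonalEqBot (orthonormal_hartley.comp σ σ.injective) hspan
    lam := fun n => nsq (σ n)
    lam_pos := fun n => by exact_mod_cast nsq_pos (σ n).2
    lam_mono := fun m n h => Int.cast_le.2 (hσ h)
    eigen := fun n => by
      rw [HilbertBasis.coe_mkOfOrthogonalEqBot, isNegLaplacian_iff]
      intro l
      rw [casCoeff_smul, Function.comp_apply, casCoeff_hartley]
      split_ifs with h
      · rw [h]
      · simp }⟩

/-! ### Arbitrary eigenbases in terms of the Hartley basis -/

theorem hasSum_hartley (u : H) :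
    HasSum (fun l : Freq => (inner ℝ (hartley l) u) • hartley l) u := by
  have := hartleyBasis.hasSum_repr u
  simpa only [HilbertBasis.repr_apply_apply, coe_hartleyBasis] using this

theorem hasSum_sq_inner_hartley (u : H) :
    HasSum (fun l : Freq => (inner ℝ (hartley l) u) ^ 2) (‖u‖ ^ 2) := by
  have := hartleyBasis.hasSum_inner_mul_inner u u
  rw [real_inner_self_eq_norm_sq] at this
  simpa only [coe_hartleyBasis, real_inner_comm, pow_two] using this

theorem exists_inner_eq_of_summable_sq {E : Type*} [NormedAddCommGroup E] [InnerProductSpace ℝ E]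
    (e : HilbertBasis ℕ ℝ E) (c : ℕ → ℝ) (hc : Summable fun n => c n ^ 2) :
    ∃ U : E, (∀ n, inner ℝ (e n) U = c n) ∧ ‖U‖ ^ 2 = ∑' n, c n ^ 2 := by
  have hm : Memℓp c 2 := by
    rw [memℓp_gen_iff (by norm_num)]
    simpa using hc
  have h : ∀ n, inner ℝ (e n) (e.repr.symm ⟨c, hm⟩) = c n := fun n => by
    rw [← HilbertBasis.repr_apply_apply, LinearIsometryEquiv.apply_symm_apply]
  refine ⟨e.repr.symm ⟨c, hm⟩, h, ?_⟩
  rw [← real_inner_self_eq_norm_sq, ← e.tsum_inner_mul_inner]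
  refine tsum_congr fun n => ?_
  rw [real_inner_comm, h, pow_two]

theorem inner_middleProj {E : Type*} [NormedAddCommGroup E] [InnerProductSpace ℝ E]
    [CompleteSpace E] (e : HilbertBasis ℕ ℝ E) (lam : ℕ → ℝ) (k : ℝ) (N : ℕ) (u : E) (n : ℕ) :
    inner ℝ (e n) (middleProj e lam k N u) =
      (Icc (lam N - k) (lam N + k)).indicator 1 (lam n) * inner ℝ (e n) u := by
  have hs : Summable fun n => (inner ℝ (e n) u) • e n := by
    have := (e.hasSum_repr u).summable
    simpa only [HilbertBasis.repr_apply_apply] using this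
  have hs' := hs.indicator {n | lam N - k ≤ lam n ∧ lam n ≤ lam N + k}
  have h := (hs'.hasSum.mapL (innerSL ℝ (e n))).tsum_eq.symm
  simp only [innerSL_apply_apply] at h
  rw [middleProj, h, tsum_eq_single n]
  · by_cases hn : lam N - k ≤ lam n ∧ lam n ≤ lam N + k
    · rw [indicator_of_mem (by exact hn), indicator_of_mem (by exact hn), inner_smul_right,
        real_inner_self_eq_norm_sq, e.orthonormal.1 n]
      simp
    · rw [indicator_of_notMem (by exact hn), indicator_of_notMem (by exact hn)]
      simp
  · intro m hm
    rw [indicator_apply]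
    split_ifs
    · rw [inner_smul_right, e.orthonormal.2 hm.symm, mul_zero]
    · simp

namespace LaplaceEigensystem

variable (S : LaplaceEigensystem)

theorem casCoeff_e_eq_zero {n : ℕ} {l : Fin 3 → ℤ} (h : S.lam n ≠ nsq l) :
    casCoeff l (S.e n) = 0 := by
  have := (isNegLaplacian_iff _ _).1 (S.eigen n) l
  rw [casCoeff_smul] at this
  have h' : (S.lam n - nsq l) * casCoeff l (S.e n) = 0 := by linarith
  exact (mul_eq_zero.1 h').resolve_left (sub_ne_zero.2 h)

theorem inner_hartley_e_eq_zero {n : ℕ} {l : Freq} (h : S.lam n ≠ nsq l) :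
    inner ℝ (hartley l) (S.e n) = 0 := by
  rw [inner_hartley, S.casCoeff_e_eq_zero h, mul_zero]

/-- A function of the Laplacian is diagonal in the Hartley basis. -/
theorem inner_hartley_of_inner_e (φ : ℝ → ℝ) {u U : H}
    (hU : ∀ n, inner ℝ (S.e n) U = φ (S.lam n) * inner ℝ (S.e n) u) (l : Freq) :
    inner ℝ (hartley l) U = φ (nsq l) * inner ℝ (hartley l) u := by
  rw [← S.e.tsum_inner_mul_inner (hartley l) U, ← S.e.tsum_inner_mul_inner (hartley l) u,
    ← tsum_mul_left]
  refine tsum_congr fun n => ?_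
  rw [hU]
  -- Eigenvectors of different eigenvalues are orthogonal, so only terms with `λ_n = |l|²`
  -- contribute.
  by_cases h : S.lam n = nsq l
  · rw [h]; ring
  · rw [S.inner_hartley_e_eq_zero h]; ring

theorem exists_lam_eq (l : Freq) : ∃ n, S.lam n = nsq l := by
  by_contra! h
  have h1 : inner ℝ (hartley l) (hartley l) = (1 : ℝ) := by
    rw [real_inner_self_eq_norm_sq, orthonormal_hartley.1 l]; norm_num
  rw [← S.e.tsum_inner_mul_inner] at h1
  simp [S.inner_hartley_e_eq_zero (h _)] at h1

theorem exists_nsq_eq (n : ℕ) : ∃ l : Freq, S.lam n = nsq l := by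
  by_contra! h
  have h1 := hasSum_sq_inner_hartley (S.e n)
  simp only [S.inner_hartley_e_eq_zero (h _), S.e.orthonormal.1 n] at h1
  have := h1.unique (hasSum_zero.congr_fun (by simp))
  norm_num at this

/-- Bounded eigenvalues would confine all `e_n` to the span of finitely many `hartley l`. Each
coordinate of `e_n` there tends to zero by Bessel, yet the squares sum to 1. -/
theorem exists_lt_lam (X : ℝ) : ∃ n, X < S.lam n := by
  by_contra! h
  set A := (finite_freq_nsq_le ⌊X⌋).toFinset with hA
  have h1 : ∀ n, ∑ l ∈ A, (inner ℝ (hartley l) (S.e n)) ^ 2 = 1 := fun n => by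
    have h1 := hasSum_sq_inner_hartley (S.e n)
    rw [S.e.orthonormal.1 n, one_pow] at h1
    refine (hasSum_sum_of_ne_finset_zero fun l hl => ?_).unique h1
    rw [S.inner_hartley_e_eq_zero, zero_pow two_ne_zero]
    intro hln
    apply hl
    rw [hA, Finite.mem_toFinset]
    exact Int.le_floor.2 (hln ▸ h n)
  have h2 : Filter.Tendsto (fun n => ∑ l ∈ A, (inner ℝ (hartley l) (S.e n)) ^ 2) Filter.atTop
      (nhds (∑ l ∈ A, 0)) := by
    refine tendsto_finsetSum _ fun l _ => ?_
    have := (S.e.summable_inner_mul_inner (hartley l) (hartley l)).tendsto_atTop_zero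
    refine this.congr fun n => ?_
    rw [real_inner_comm (hartley l) (S.e n), pow_two]
  simp only [h1, Finset.sum_const_zero] at h2
  exact one_ne_zero (tendsto_nhds_unique tendsto_const_nhds h2)

/-- Every eigenvalue is the last in its group, with a unit gap behind it, for a suitable index. -/
theorem exists_gap (l : Freq) : ∃ N, S.lam N = nsq l ∧ 1 ≤ S.lam (N + 1) - S.lam N := by
  classical
  have hex := S.exists_lt_lam (nsq l)
  obtain ⟨n, hn⟩ := S.exists_lam_eq l
  have hlt := Nat.find_spec hex
  have hmin : ∀ m < Nat.find hex, S.lam m ≤ nsq l := fun m hm => not_lt.1 (Nat.find_min hex hm)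
  have hn' : n < Nat.find hex := by
    by_contra! h
    have := S.lam_mono h
    linarith
  -- `N` is the index just before the first eigenvalue exceeding `|l|²`.
  obtain ⟨N, hN⟩ := Nat.exists_eq_succ_of_ne_zero (Nat.ne_of_gt (Nat.zero_lt_of_lt hn'))
  rw [hN] at hlt hmin hn'
  have hNl : S.lam N = nsq l := le_antisymm (hmin N (Nat.lt_succ_self N))
    (hn ▸ S.lam_mono (Nat.lt_succ_iff.1 hn'))
  refine ⟨N, hNl, ?_⟩
  obtain ⟨m, hm⟩ := S.exists_nsq_eq (N + 1)
  rw [Nat.succ_eq_add_one, hm] at hlt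
  rw [hNl, hm]
  have : (nsq l : ℤ) + 1 ≤ nsq m := by exact_mod_cast hlt
  have : ((nsq l : ℤ) : ℝ) + 1 ≤ nsq m := by exact_mod_cast this
  linarith

/-- `U` is `A^{s/2} u`, provided by Riesz–Fischer. -/
theorem exists_of_sobolevNormLE {s R : ℝ} {u : H} (h : SobolevNormLE S.e S.lam s R u) :
    ∃ U : H, ‖U‖ ≤ R ∧ ∀ l : Freq,
      inner ℝ (hartley l) U = (nsq l : ℝ) ^ (s / 2) * inner ℝ (hartley l) u := by
  obtain ⟨hs, hR⟩ := h
  have e : ∀ n, S.lam n ^ s * inner ℝ (S.e n) u ^ 2 =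
      (S.lam n ^ (s / 2) * inner ℝ (S.e n) u) ^ 2 := fun n => by
    rw [mul_pow, ← Real.rpow_natCast (S.lam n ^ (s / 2)), ← Real.rpow_mul (S.lam_pos n).le]
    congr 2
    push_cast; ring
  simp only [e] at hs hR
  obtain ⟨U, hU, hn⟩ := exists_inner_eq_of_summable_sq S.e _ hs
  refine ⟨U, ?_, S.inner_hartley_of_inner_e (fun t => t ^ (s / 2)) hU⟩
  rwa [← hn, Real.sqrt_sq (norm_nonneg U)] at hR

theorem inner_hartley_middleProj (k : ℝ) (N : ℕ) (u : H) (l : Freq) :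
    inner ℝ (hartley l) (middleProj S.e S.lam k N u) =
      (Icc (S.lam N - k) (S.lam N + k)).indicator 1 (nsq l : ℝ) * inner ℝ (hartley l) u :=
  S.inner_hartley_of_inner_e ((Icc (S.lam N - k) (S.lam N + k)).indicator 1)
    (inner_middleProj S.e S.lam k N u) l

end LaplaceEigensystem

/-! ### Smooth functions and trigonometric polynomials -/

theorem summable_nsq_rpow {s : ℝ} (hs : 3 / 2 < s) :
    Summable fun l : Freq => (nsq l : ℝ) ^ (-s) := by
  let L : Submodule ℤ (Fin 3 → ℝ) := Submodule.span ℤ (range (Pi.basisFun ℝ (Fin 3)))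
  have hrank : Module.finrank ℤ L = 3 := by
    rw [ZLattice.rank ℝ L]; simp
  have h := ZLattice.summable_norm_rpow L (-2 * s) (by rw [hrank]; push_cast; linarith)
  have hmem : ∀ l : Freq, (fun i => ((l : Fin 3 → ℤ) i : ℝ)) ∈ L := fun l => by
    rw [← (Pi.basisFun ℝ (Fin 3)).sum_repr (fun i => ((l : Fin 3 → ℤ) i : ℝ))]
    refine Submodule.sum_mem _ fun i _ => ?_
    have : ((Pi.basisFun ℝ (Fin 3)).repr (fun i => ((l : Fin 3 → ℤ) i : ℝ))) i •
        (Pi.basisFun ℝ (Fin 3)) i = ((l : Fin 3 → ℤ) i) • (Pi.basisFun ℝ (Fin 3)) i := by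
      rw [Pi.basisFun_repr, Int.cast_smul_eq_zsmul]
    rw [this]
    exact Submodule.smul_mem _ _ (Submodule.subset_span ⟨i, rfl⟩)
  have hinj : Function.Injective fun l : Freq => (⟨_, hmem l⟩ : L) := fun l m hlm => by
    refine Subtype.ext (funext fun i => ?_)
    exact Int.cast_injective (α := ℝ) (congrFun (congrArg Subtype.val hlm) i)
  refine Summable.of_nonneg_of_le (fun l => ?_) (fun l => ?_) (h.comp_injective hinj)
  · exact Real.rpow_nonneg (by exact_mod_cast nsq_nonneg _) _
  · have hpos : 0 < ‖(fun i => ((l : Fin 3 → ℤ) i : ℝ))‖ := by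
      rw [norm_pos_iff]
      intro h0
      refine l.2 (funext fun i => ?_)
      exact Int.cast_injective (α := ℝ) ((congrFun h0 i).trans (by simp))
    have hle : ‖(fun i => ((l : Fin 3 → ℤ) i : ℝ))‖ ^ 2 ≤ nsq l := by
      have hn : (0 : ℝ) ≤ nsq l := by exact_mod_cast nsq_nonneg _
      rw [← Real.le_sqrt (norm_nonneg _) hn, pi_norm_le_iff_of_nonneg (Real.sqrt_nonneg _)]
      intro i
      rw [Real.norm_eq_abs]
      exact Real.abs_le_sqrt (by exact_mod_cast sq_le_nsq l i)
    change _ ≤ ‖(fun i => ((l : Fin 3 → ℤ) i : ℝ))‖ ^ (-2 * s)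
    have e : ‖(fun i => ((l : Fin 3 → ℤ) i : ℝ))‖ ^ (-2 * s) =
        (‖(fun i => ((l : Fin 3 → ℤ) i : ℝ))‖ ^ 2) ^ (-s) := by
      rw [← Real.rpow_natCast, ← Real.rpow_mul hpos.le]
      congr 1; push_cast; ring
    rw [e]
    exact Real.rpow_le_rpow_of_nonpos (by positivity) hle (by linarith)

theorem coe_hartley (l : Freq) : (hartley l : L2) = contToL2 (casNorm • cas l) := by
  rw [map_smul]; rfl

/-- Young's inequality with a free weight `η`: the first term is summable over frequencies when `s >
3/2`, the second is controlled by `‖U‖²`. -/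
theorem abs_inner_hartley_le {s : ℝ} {u U : H} {l : Freq}
    (h : inner ℝ (hartley l) U = (nsq l : ℝ) ^ (s / 2) * inner ℝ (hartley l) u) {η : ℝ}
    (hη : 0 < η) :
    |inner ℝ (hartley l) u| ≤ (nsq l : ℝ) ^ (-s) / η + η * (inner ℝ (hartley l) U) ^ 2 := by
  have hp : (0 : ℝ) < nsq l := by exact_mod_cast nsq_pos l.2
  set w : ℝ := (nsq l : ℝ) ^ (-(s / 2)) with hw
  have hw0 : 0 < w := Real.rpow_pos_of_pos hp _
  have h1 : inner ℝ (hartley l) u = w * inner ℝ (hartley l) U := by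
    rw [h, hw, ← mul_assoc, ← Real.rpow_add hp]; simp
  have h2 : (nsq l : ℝ) ^ (-s) = w ^ 2 := by
    rw [hw, ← Real.rpow_natCast, ← Real.rpow_mul hp.le]
    congr 1; push_cast; ring
  rw [h1, h2, abs_mul, abs_of_pos hw0, ← sq_abs (inner ℝ (hartley l) U)]
  set t := |inner ℝ (hartley l) U|
  rw [← sub_nonneg]
  have : w ^ 2 / η + η * t ^ 2 - w * t =
      ((w - η * t / 2) ^ 2 + 3 / 4 * (η * t) ^ 2) / η := by
    field_simp; ring
  rw [this]
  positivity

/-- Functions bounded in `H^s`, `s > 3/2`, are uniformly approximated by trigonometric polynomials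
of a fixed degree. -/
theorem exists_trig_approx {s : ℝ} (hs : 3 / 2 < s) (R : ℝ) {ε : ℝ} (hε : 0 < ε) :
    ∃ A : Finset (Fin 3 → ℤ), ∃ B : ℝ, ∀ u U : H, ‖U‖ ≤ R →
      (∀ l : Freq, inner ℝ (hartley l) U = (nsq l : ℝ) ^ (s / 2) * inner ℝ (hartley l) u) →
      ∃ P ∈ trigSpan A, ‖P‖ ≤ B ∧ ∀ᵐ x, |(u : L2) x - P x| ≤ ε := by
  classical
  set c := 2 * casNorm with hc
  have hc0 : 0 < c := mul_pos two_pos casNorm_pos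
  set w : Freq → ℝ := fun l => (nsq l : ℝ) ^ (-s) with hw
  have hws : Summable w := summable_nsq_rpow hs
  have hw0 : ∀ l, 0 ≤ w l := fun l => Real.rpow_nonneg (by exact_mod_cast nsq_nonneg _) _
  -- `η` makes the `U` part of the tail at most `ε/2`; `A` is then chosen, independently of `u`, so
  -- that the weights outside it contribute at most `ε/2`. Weight 1 is used for absolute convergence
  -- and for the bound `B`.
  set η := ε / (2 * c * (R ^ 2 + 1)) with hη
  have hη0 : 0 < η := by positivity
  have ht := tendsto_tsum_compl_atTop_zero w
  obtain ⟨A, hA⟩ := ((tendsto_order.1 ht).2 (ε * η / (2 * c)) (by positivity)).exists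
  refine ⟨A.image Subtype.val, c * (∑' l, w l + R ^ 2), fun u U hU h => ?_⟩
  have hb := hasSum_sq_inner_hartley U
  have hUR : ‖U‖ ^ 2 ≤ R ^ 2 := pow_le_pow_left₀ (norm_nonneg U) hU 2
  let q : Freq → C(Torus, ℝ) := fun l => (inner ℝ (hartley l) u * casNorm) • cas l
  have hq : ∀ l, ∀ θ > 0, ‖q l‖ ≤ c * (w l / θ + θ * (inner ℝ (hartley l) U) ^ 2) := fun l θ hθ => by
    have h1 := abs_inner_hartley_le (h l) hθ
    calc ‖q l‖ ≤ |inner ℝ (hartley l) u * casNorm| * 2 := by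
          rw [norm_smul, Real.norm_eq_abs]
          exact mul_le_mul_of_nonneg_left (norm_cas_le _) (abs_nonneg _)
      _ = c * |inner ℝ (hartley l) u| := by
          rw [abs_mul, abs_of_pos casNorm_pos, hc]; ring
      _ ≤ _ := mul_le_mul_of_nonneg_left h1 hc0.le
  have hdom : ∀ θ : ℝ, HasSum (fun l => c * (w l / θ + θ * (inner ℝ (hartley l) U) ^ 2))
      (c * ((∑' l, w l) / θ + θ * ‖U‖ ^ 2)) := fun θ =>
    ((hws.hasSum.div_const θ).add (hb.mul_left θ)).mul_left c
  have hqs : Summable fun l => ‖q l‖ :=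
    Summable.of_nonneg_of_le (fun _ => norm_nonneg _) (fun l => hq l 1 one_pos) (hdom 1).summable
  have hqs' : Summable q := hqs.of_norm
  have hsum : contToL2 (∑' l, q l) = (u : L2) := by
    refine ((hqs'.hasSum.mapL contToL2).unique ?_)
    have := (hasSum_hartley u).mapL H.subtypeL
    refine this.congr_fun fun l => ?_
    simp only [q, map_smul, Submodule.subtypeL_apply, coe_hartley, smul_smul]
  refine ⟨∑ l ∈ A, q l, ?_, ?_, ?_⟩
  · refine Submodule.sum_mem _ fun l hl => Submodule.smul_mem _ _ (cas_mem_trigSpan ?_)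
    simpa using ⟨l.2, hl⟩
  · calc ‖∑ l ∈ A, q l‖ ≤ ∑ l ∈ A, ‖q l‖ := norm_sum_le _ _
      _ ≤ ∑ l ∈ A, c * (w l / 1 + 1 * (inner ℝ (hartley l) U) ^ 2) :=
          Finset.sum_le_sum fun l _ => hq l 1 one_pos
      _ ≤ c * ((∑' l, w l) / 1 + 1 * ‖U‖ ^ 2) :=
          sum_le_hasSum _ (fun l _ => by have := hw0 l; positivity) (hdom 1)
      _ ≤ _ := by
          rw [div_one, one_mul]
          exact mul_le_mul_of_nonneg_left (by linarith) hc0.le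
  · have hrest : ‖(∑' l, q l) - ∑ l ∈ A, q l‖ ≤ ε := by
      rw [← hqs'.sum_add_tsum_subtype_compl A, add_sub_cancel_left]
      have hsub : Summable fun l : {l // l ∉ A} => ‖q l‖ := hqs.comp_injective Subtype.val_injective
      have hw' : Summable fun l : {l // l ∉ A} => w l := hws.comp_injective Subtype.val_injective
      have hb' : Summable fun l : {l // l ∉ A} => (inner ℝ (hartley l.1) U) ^ 2 :=
        hb.summable.comp_injective Subtype.val_injective
      have hbt : ∑' l : {l // l ∉ A}, (inner ℝ (hartley l.1) U) ^ 2 ≤ R ^ 2 :=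
        (hb.summable.tsum_subtype_le _ _ fun l => sq_nonneg _).trans (hb.tsum_eq.le.trans hUR)
      calc ‖∑' l : {l // l ∉ A}, q l‖ ≤ ∑' l : {l // l ∉ A}, ‖q l‖ := norm_tsum_le_tsum_norm hsub
        _ ≤ ∑' l : {l // l ∉ A}, c * (w l / η + η * (inner ℝ (hartley l.1) U) ^ 2) :=
            hsub.tsum_le_tsum (fun l => hq l η hη0) (((hw'.div_const η).add (hb'.mul_left η)).mul_left c)
        _ = c * ((∑' l : {l // l ∉ A}, w l) / η +
              η * ∑' l : {l // l ∉ A}, (inner ℝ (hartley l.1) U) ^ 2) := by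
            rw [tsum_mul_left, (hw'.div_const η).tsum_add (hb'.mul_left η), tsum_div_const,
              tsum_mul_left]
        _ ≤ c * ((ε * η / (2 * c)) / η + η * R ^ 2) := by gcongr
        _ ≤ c * ((ε * η / (2 * c)) / η + η * (R ^ 2 + 1)) := by gcongr; linarith
        _ = ε := by rw [hη]; field_simp; ring
    have hae := ContinuousMap.coeFn_toLp (p := 2) (𝕜 := ℝ) (volume : Measure Torus) (∑' l, q l)
    rw [hsum] at hae
    filter_upwards [hae] with x hx
    rw [hx, ← Real.norm_eq_abs, ← ContinuousMap.sub_apply]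
    exact (ContinuousMap.norm_coe_le_norm _ x).trans hrest

theorem exists_finset_mul_mem_trigSpan (A A' : Finset (Fin 3 → ℤ)) : ∃ D : Finset (Fin 3 → ℤ),
    ∀ f ∈ trigSpan A, ∀ g ∈ trigSpan A', f * g ∈ trigSpan D := by
  classical
  refine ⟨(A ×ˢ A').image (fun t => t.1 - t.2) ∪ (A ×ˢ A').image (fun t => t.2 - t.1) ∪
    (A ×ˢ A').image (fun t => t.1 + t.2) ∪ (A ×ˢ A').image (fun t => -t.1 - t.2),
    fun f hf g hg => mul_mem_trigSpan hf hg fun a ha b hb => ?_⟩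
  simp only [Finset.mem_coe, Finset.mem_union, Finset.mem_image, Finset.mem_product]
  refine ⟨?_, ?_, ?_, ?_⟩
  · exact Or.inl (Or.inl (Or.inl ⟨(a, b), ⟨ha, hb⟩, rfl⟩))
  · exact Or.inl (Or.inl (Or.inr ⟨(a, b), ⟨ha, hb⟩, rfl⟩))
  · exact Or.inl (Or.inr ⟨(a, b), ⟨ha, hb⟩, rfl⟩)
  · exact Or.inr ⟨(a, b), ⟨ha, hb⟩, rfl⟩

theorem exists_finset_aeval_mem_trigSpan (A : Finset (Fin 3 → ℤ)) (p : Polynomial ℝ) :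
    ∃ D : Finset (Fin 3 → ℤ), ∀ f ∈ trigSpan A, Polynomial.aeval f p ∈ trigSpan D := by
  classical
  induction p using Polynomial.induction_on' with
  | add p q hp hq =>
    obtain ⟨D, hD⟩ := hp
    obtain ⟨D', hD'⟩ := hq
    refine ⟨D ∪ D', fun f hf => ?_⟩
    rw [map_add]
    exact Submodule.add_mem _ (trigSpan_mono (by simp) (hD f hf))
      (trigSpan_mono (by simp) (hD' f hf))
  | monomial n a =>
    have : ∃ D : Finset (Fin 3 → ℤ), ∀ f ∈ trigSpan A, f ^ n ∈ trigSpan D := by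
      induction n with
      | zero => exact ⟨{0}, fun f _ => by
          rw [pow_zero, ← cas_zero]; exact cas_mem_trigSpan (by simp)⟩
      | succ n ih =>
        obtain ⟨D, hD⟩ := ih
        obtain ⟨D', hD'⟩ := exists_finset_mul_mem_trigSpan D A
        exact ⟨D', fun f hf => by rw [pow_succ]; exact hD' _ (hD f hf) _ hf⟩
    obtain ⟨D, hD⟩ := this
    refine ⟨D, fun f hf => ?_⟩
    rw [Polynomial.aeval_monomial, ← Algebra.smul_def]
    exact Submodule.smul_mem _ _ (hD f hf)

/-- Half of the error comes from replacing `u` by `P`, through the Lipschitz bound, and half from a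
Weierstrass polynomial for `g` on `[-B, B]`. A fixed polynomial in `P` has frequencies in a fixed
finite set. -/
theorem exists_trig_approx_comp {s : ℝ} (hs : 3 / 2 < s) (R : ℝ) {ε : ℝ} (hε : 0 < ε)
    {g : ℝ → ℝ} {C : NNReal} (hg : LipschitzWith C g) :
    ∃ D : Finset (Fin 3 → ℤ), ∀ u U : H, ‖U‖ ≤ R →
      (∀ l : Freq, inner ℝ (hartley l) U = (nsq l : ℝ) ^ (s / 2) * inner ℝ (hartley l) u) →
      ∃ T ∈ trigSpan D, ∀ᵐ x, |g ((u : L2) x) - T x| ≤ ε := by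
  obtain ⟨A, B, hAB⟩ := exists_trig_approx hs R (ε := ε / (2 * (C + 1))) (by positivity)
  obtain ⟨p, hp⟩ := exists_polynomial_near_of_continuousOn (-B) B g hg.continuous.continuousOn
    (ε / 2) (by positivity)
  obtain ⟨D, hD⟩ := exists_finset_aeval_mem_trigSpan A p
  refine ⟨D, fun u U hU h => ?_⟩
  obtain ⟨P, hP, hPB, hae⟩ := hAB u U hU h
  refine ⟨_, hD P hP, ?_⟩
  filter_upwards [hae] with x hx
  have hPx : P x ∈ Icc (-B) B := abs_le.1 ((P.norm_coe_le_norm x).trans hPB)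
  have h1 := hp (P x) hPx
  have h2 := hg.dist_le_mul ((u : L2) x) (P x)
  rw [Real.dist_eq, Real.dist_eq] at h2
  have h3 : (C : ℝ) * |(u : L2) x - P x| ≤ ε / 2 := by
    calc (C : ℝ) * |(u : L2) x - P x| ≤ (C + 1) * (ε / (2 * (C + 1))) := by gcongr; linarith
      _ = ε / 2 := by field_simp
  have h4 : (Polynomial.aeval P p) x = p.eval (P x) := by
    rw [Polynomial.aeval_continuousMap_apply]
  rw [h4]
  rw [abs_sub_comm] at h1
  calc |g ((u : L2) x) - p.eval (P x)| ≤ |g ((u : L2) x) - g (P x)| + |g (P x) - p.eval (P x)| :=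
        abs_sub_le _ _ _
    _ ≤ ε := by linarith

theorem exists_sub_const_mem_trigSpan {D : Set (Fin 3 → ℤ)} {T : C(Torus, ℝ)}
    (hT : T ∈ trigSpan D) : ∃ τ : ℝ, T - τ • 1 ∈ trigSpan (D \ {0}) := by
  have h : trigSpan D ≤ Submodule.span ℝ (insert (cas 0) (cas '' (D \ {0}))) := by
    rw [trigSpan, ← image_insert_eq]
    exact Submodule.span_mono (image_mono fun l hl => by
      by_cases h0 : l = 0
      · exact Or.inl h0
      · exact Or.inr ⟨hl, h0⟩)
  obtain ⟨τ, z, hz, hTz⟩ := Submodule.mem_span_insert.1 (h hT)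
  refine ⟨τ, ?_⟩
  rw [hTz, cas_zero, add_sub_cancel_left]
  exact hz

/-! ### The superposition operator -/

namespace Admissible

theorem contDiff_deriv {f : ℝ → ℝ} {K L : ℝ} (hf : Admissible f K L) : ContDiff ℝ 2 (deriv f) := by
  have h : ContDiff ℝ (2 + 1) f := by
    have := hf.contDiff
    norm_num
    exact this
  exact (contDiff_succ_iff_deriv.1 h).2.2

theorem differentiable {f : ℝ → ℝ} {K L : ℝ} (hf : Admissible f K L) : Differentiable ℝ f :=
  hf.contDiff.differentiable (by norm_num)

theorem continuous_deriv {f : ℝ → ℝ} {K L : ℝ} (hf : Admissible f K L) : Continuous (deriv f) :=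
  hf.contDiff_deriv.continuous

theorem abs_le {f : ℝ → ℝ} {K L : ℝ} (hf : Admissible f K L) (z : ℝ) : |f z| ≤ K := by
  have := hf.bound z
  have := abs_nonneg (deriv (deriv f) z)
  linarith

theorem nonneg_left {f : ℝ → ℝ} {K L : ℝ} (hf : Admissible f K L) : 0 ≤ K :=
  (abs_nonneg _).trans (hf.abs_le 0)

theorem nonneg_right {f : ℝ → ℝ} {K L : ℝ} (hf : Admissible f K L) : 0 ≤ L :=
  (abs_nonneg _).trans (hf.bound_deriv 0)

theorem lipschitzWith {f : ℝ → ℝ} {K L : ℝ} (hf : Admissible f K L) :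
    LipschitzWith L.toNNReal f :=
  lipschitzWith_of_nnnorm_deriv_le hf.differentiable fun z => by
    rw [← NNReal.coe_le_coe, coe_nnnorm, Real.coe_toNNReal _ hf.nonneg_right]
    exact hf.bound_deriv z

theorem abs_sub_le {f : ℝ → ℝ} {K L : ℝ} (hf : Admissible f K L) (y z : ℝ) :
    |f y - f z| ≤ L * |y - z| := by
  have := hf.lipschitzWith.dist_le_mul y z
  rwa [Real.dist_eq, Real.dist_eq, Real.coe_toNNReal _ hf.nonneg_right] at this

theorem lipschitzWith_deriv {f : ℝ → ℝ} {K L : ℝ} (hf : Admissible f K L) :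
    LipschitzWith K.toNNReal (deriv f) :=
  lipschitzWith_of_nnnorm_deriv_le (hf.contDiff_deriv.differentiable (by norm_num)) fun z => by
    rw [← NNReal.coe_le_coe, coe_nnnorm, Real.coe_toNNReal _ hf.nonneg_left]
    have := hf.bound z
    have := abs_nonneg (f z)
    rw [Real.norm_eq_abs]
    linarith

end Admissible

theorem memLp_bounded_mul {w : Torus → ℝ} {C : ℝ} (hw : AEStronglyMeasurable w volume)
    (hC : ∀ x, |w x| ≤ C) (u : L2) : MemLp (fun x => w x * u x) 2 (volume : Measure Torus) :=
  (Lp.memLp u).of_le_mul (c := C) (hw.mul (Lp.aestronglyMeasurable u))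
    (Filter.Eventually.of_forall fun x => by
      rw [norm_mul]; exact mul_le_mul_of_nonneg_right (hC x) (norm_nonneg _))

theorem norm_toLp_bounded_mul_le {w : Torus → ℝ} {C : ℝ} (hw : AEStronglyMeasurable w volume)
    (hC : ∀ x, |w x| ≤ C) (u : L2) : ‖(memLp_bounded_mul hw hC u).toLp‖ ≤ C * ‖u‖ :=
  Lp.norm_le_mul_norm_of_ae_le_mul (by
    filter_upwards [(memLp_bounded_mul hw hC u).coeFn_toLp] with x hx
    rw [hx, norm_mul]
    exact mul_le_mul_of_nonneg_right (hC x) (norm_nonneg _))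

/-- The operator of multiplication by a bounded function on `L²`. -/
def mulOp (w : Torus → ℝ) (C : ℝ) (hw : AEStronglyMeasurable w volume) (hC : ∀ x, |w x| ≤ C) :
    L2 →L[ℝ] L2 :=
  LinearMap.mkContinuous
    { toFun := fun u => (memLp_bounded_mul hw hC u).toLp
      map_add' := fun u v => by
        rw [← MemLp.toLp_add]
        refine MemLp.toLp_congr _ _ ?_
        filter_upwards [Lp.coeFn_add u v] with x hx
        rw [hx, Pi.add_apply, Pi.add_apply, mul_add]
      map_smul' := fun c u => by
        rw [RingHom.id_apply, ← MemLp.toLp_const_smul]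
        refine MemLp.toLp_congr _ _ ?_
        filter_upwards [Lp.coeFn_smul c u] with x hx
        rw [hx, Pi.smul_apply, Pi.smul_apply, smul_eq_mul, smul_eq_mul, mul_left_comm] }
    C (norm_toLp_bounded_mul_le hw hC)

theorem coeFn_mulOp (w : Torus → ℝ) (C : ℝ) (hw : AEStronglyMeasurable w volume)
    (hC : ∀ x, |w x| ≤ C) (u : L2) : mulOp w C hw hC u =ᵐ[volume] fun x => w x * u x :=
  (memLp_bounded_mul hw hC u).coeFn_toLp

theorem norm_mulOp_le (w : Torus → ℝ) (C : ℝ) (hw : AEStronglyMeasurable w volume)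
    (hC : ∀ x, |w x| ≤ C) (h0 : 0 ≤ C) : ‖mulOp w C hw hC‖ ≤ C :=
  LinearMap.mkContinuous_norm_le _ h0 (norm_toLp_bounded_mul_le hw hC)

/-- Serves both the Gateaux derivative and the strong continuity of the derivative along segments.
-/
theorem tendsto_L2_of_dominated {l : Filter ℝ} [l.IsCountablyGenerated] {G : ℝ → L2} {G₀ : L2}
    {Φ : ℝ → Torus → ℝ} {γ b : Torus → ℝ} (hb : MemLp b 2 (volume : Measure Torus))
    (hG : ∀ t, G t =ᵐ[volume] Φ t) (hG₀ : G₀ =ᵐ[volume] γ)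
    (hbound : ∀ t x, |Φ t x - γ x| ≤ b x)
    (hlim : ∀ x, Filter.Tendsto (fun t => Φ t x) l (nhds (γ x))) :
    Filter.Tendsto G l (nhds G₀) := by
  have hsq : ∀ t, ‖G t - G₀‖ ^ 2 = ∫ x, (Φ t x - γ x) ^ 2 := fun t => by
    rw [← real_inner_self_eq_norm_sq, L2.inner_def]
    refine integral_congr_ae ?_
    filter_upwards [Lp.coeFn_sub (G t) G₀, hG t, hG₀] with x h1 h2 h3
    rw [h1, Pi.sub_apply, h2, h3]
    simp [pow_two]
  have hmeas : ∀ t, AEStronglyMeasurable (fun x => (Φ t x - γ x) ^ 2) volume := fun t =>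
    (((Lp.aestronglyMeasurable (G t)).congr (hG t)).sub
      ((Lp.aestronglyMeasurable G₀).congr hG₀)).pow 2
  have h : Filter.Tendsto (fun t => ∫ x, (Φ t x - γ x) ^ 2) l (nhds (∫ x : Torus, (0 : ℝ))) := by
    refine tendsto_integral_filter_of_dominated_convergence (fun x => b x ^ 2)
      (Filter.Eventually.of_forall hmeas) (Filter.Eventually.of_forall fun t =>
        Filter.Eventually.of_forall fun x => ?_) hb.integrable_sq
      (Filter.Eventually.of_forall fun x => ?_)
    · rw [norm_pow, Real.norm_eq_abs]
      exact pow_le_pow_left₀ (abs_nonneg _) (hbound t x) 2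
    · have := ((hlim x).sub_const (γ x)).pow 2
      simpa using this
  rw [integral_zero] at h
  rw [tendsto_iff_norm_sub_tendsto_zero]
  have h2 := (Real.continuous_sqrt.tendsto 0).comp h
  rw [Real.sqrt_zero] at h2
  refine h2.congr fun t => ?_
  rw [Function.comp_apply, ← hsq, Real.sqrt_sq (norm_nonneg _)]

namespace Admissible

/-- The superposition operator `u ↦ f ∘ u` on `L²`. -/
def superposition {f : ℝ → ℝ} {K L : ℝ} (hf : Admissible f K L) (u : L2) : L2 :=
  (MemLp.of_bound (hf.contDiff.continuous.comp_aestronglyMeasurable (Lp.aestronglyMeasurable u)) K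
    (Filter.Eventually.of_forall fun x => hf.abs_le (u x)) :
      MemLp (fun x => f (u x)) 2 (volume : Measure Torus)).toLp

theorem coeFn_superposition {f : ℝ → ℝ} {K L : ℝ} (hf : Admissible f K L) (u : L2) :
    hf.superposition u =ᵐ[volume] fun x => f (u x) := MemLp.coeFn_toLp _

/-- Multiplication by `f' ∘ u` on `L²`. -/
def superpositionDeriv {f : ℝ → ℝ} {K L : ℝ} (hf : Admissible f K L) (u : L2) : L2 →L[ℝ] L2 :=
  mulOp (fun x => deriv f (u x)) L
    (hf.continuous_deriv.comp_aestronglyMeasurable (Lp.aestronglyMeasurable u))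
    fun x => hf.bound_deriv (u x)

theorem coeFn_superpositionDeriv {f : ℝ → ℝ} {K L : ℝ} (hf : Admissible f K L) (u v : L2) :
    hf.superpositionDeriv u v =ᵐ[volume] fun x => deriv f (u x) * v x := coeFn_mulOp _ _ _ _ _

theorem norm_superposition_sub_le {f : ℝ → ℝ} {K L : ℝ} (hf : Admissible f K L) (u v : L2) :
    ‖hf.superposition u - hf.superposition v‖ ≤ L * ‖u - v‖ := by
  refine Lp.norm_le_mul_norm_of_ae_le_mul ?_
  filter_upwards [Lp.coeFn_sub (hf.superposition u) (hf.superposition v), Lp.coeFn_sub u v,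
    hf.coeFn_superposition u, hf.coeFn_superposition v] with x h1 h2 h3 h4
  rw [h1, h2, Pi.sub_apply, Pi.sub_apply, h3, h4]
  exact hf.abs_sub_le _ _

theorem norm_superposition_le {f : ℝ → ℝ} {K L : ℝ} (hf : Admissible f K L) (u : L2) :
    ‖hf.superposition u‖ ≤ K * ‖contToL2 1‖ := by
  refine Lp.norm_le_mul_norm_of_ae_le_mul ?_
  filter_upwards [hf.coeFn_superposition u,
    ContinuousMap.coeFn_toLp (p := 2) (𝕜 := ℝ) (volume : Measure Torus) (1 : C(Torus, ℝ))]
    with x h1 h2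
  rw [h1, h2]
  simpa using hf.abs_le (u x)

theorem hasLineDerivAt_superposition {f : ℝ → ℝ} {K L : ℝ} (hf : Admissible f K L) (u v : L2) :
    HasLineDerivAt ℝ hf.superposition (hf.superpositionDeriv u v) u v := by
  rw [HasLineDerivAt, hasDerivAt_iff_tendsto_slope_zero]
  simp only [zero_add, zero_smul, add_zero]
  refine tendsto_L2_of_dominated (Φ := fun t x => t⁻¹ * (f (u x + t * v x) - f (u x)))
    (γ := fun x => deriv f (u x) * v x) (b := fun x => 2 * L * |v x|)
    ((Lp.memLp v).abs.const_mul (2 * L)) (fun t => ?_) (hf.coeFn_superpositionDeriv u v)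
    (fun t x => ?_) (fun x => ?_)
  · filter_upwards [Lp.coeFn_smul t⁻¹ (hf.superposition (u + t • v) - hf.superposition u),
      Lp.coeFn_sub (hf.superposition (u + t • v)) (hf.superposition u),
      hf.coeFn_superposition (u + t • v), hf.coeFn_superposition u, Lp.coeFn_add u (t • v),
      Lp.coeFn_smul t v] with x h1 h2 h3 h4 h5 h6
    rw [h1, Pi.smul_apply, h2, Pi.sub_apply, h3, h4, h5, Pi.add_apply, h6, Pi.smul_apply,
      smul_eq_mul, smul_eq_mul]
  · have h1 : |t⁻¹ * (f (u x + t * v x) - f (u x))| ≤ L * |v x| := by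
      rw [abs_mul, abs_inv]
      -- The domination is required for every `t`; at `t = 0` the quotient is zero because `0⁻¹ =
      -- 0`.
      by_cases ht : t = 0
      · simp only [ht, abs_zero, inv_zero, zero_mul]
        exact mul_nonneg hf.nonneg_right (abs_nonneg _)
      · rw [inv_mul_le_iff₀ (abs_pos.2 ht)]
        refine (hf.abs_sub_le _ _).trans (le_of_eq ?_)
        rw [add_sub_cancel_left, abs_mul]; ring
    have h2 : |deriv f (u x) * v x| ≤ L * |v x| := by
      rw [abs_mul]
      exact mul_le_mul_of_nonneg_right (hf.bound_deriv _) (abs_nonneg _)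
    calc _ ≤ _ := abs_sub _ _
      _ ≤ 2 * L * |v x| := by linarith
  · have h1 : HasDerivAt (fun t : ℝ => u x + t * v x) (v x) 0 := by
      simpa using ((hasDerivAt_id (0 : ℝ)).mul_const (v x)).const_add (u x)
    have h2 : HasDerivAt f (deriv f (u x)) (u x + 0 * v x) := by
      simpa using (hf.differentiable (u x)).hasDerivAt
    have h3 := (h2.comp (0 : ℝ) h1).tendsto_slope_zero
    simpa using h3

theorem continuous_superpositionDeriv_segment {f : ℝ → ℝ} {K L : ℝ} (hf : Admissible f K L)
    (u₁ u₂ v : L2) :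
    Continuous fun s : ℝ => hf.superpositionDeriv (s • u₁ + (1 - s) • u₂) v := by
  rw [continuous_iff_continuousAt]
  intro s₀
  have h : ∀ s : ℝ, hf.superpositionDeriv (s • u₁ + (1 - s) • u₂) v =ᵐ[volume]
      fun x => deriv f (s * u₁ x + (1 - s) * u₂ x) * v x := fun s => by
    filter_upwards [hf.coeFn_superpositionDeriv (s • u₁ + (1 - s) • u₂) v,
      Lp.coeFn_add (s • u₁) ((1 - s) • u₂), Lp.coeFn_smul s u₁, Lp.coeFn_smul (1 - s) u₂]
      with x h1 h2 h3 h4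
    rw [h1, h2, Pi.add_apply, h3, h4]; rfl
  refine tendsto_L2_of_dominated (b := fun x => 2 * L * |v x|)
    ((Lp.memLp v).abs.const_mul (2 * L)) h (h s₀) (fun s x => ?_) (fun x => ?_)
  · rw [← sub_mul, abs_mul]
    refine mul_le_mul_of_nonneg_right ?_ (abs_nonneg _)
    refine (abs_sub _ _).trans ?_
    have h1 := hf.bound_deriv (s * u₁ x + (1 - s) * u₂ x)
    have h2 := hf.bound_deriv (s₀ * u₁ x + (1 - s₀) * u₂ x)
    linarith
  · have : Continuous fun s : ℝ => deriv f (s * u₁ x + (1 - s) * u₂ x) * v x :=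
      (hf.continuous_deriv.comp (by fun_prop)).mul continuous_const
    exact this.tendsto s₀

/-- The derivative of the nonlinearity: `v ↦ f'(u) v - ⟨f'(u) v⟩`. -/
def nonlinearityDeriv {f : ℝ → ℝ} {K L : ℝ} (hf : Admissible f K L) (u : H) : H →L[ℝ] H :=
  H.orthogonalProjectionOnto ∘L hf.superpositionDeriv u ∘L H.subtypeL

/-- Subtracting the mean is the orthogonal projection onto `H`, since constants span directions
orthogonal to it. Bounds and derivatives thus pass from `L²` to `H`. -/
theorem nonlinearity_eq {f : ℝ → ℝ} {K L : ℝ} (hf : Admissible f K L) (u : H) :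
    nonlinearity hf u = H.orthogonalProjectionOnto (hf.superposition u) := by
  set m : ℝ := ⨍ y, f ((u : L2) y) with hm
  have h1 : hf.superposition u = (nonlinearity hf u : L2) + m • contToL2 1 := by
    refine Lp.ext ?_
    filter_upwards [hf.coeFn_superposition u,
      Lp.coeFn_add (nonlinearity hf u : L2) (m • contToL2 1), (hf.memLp (u : L2)).coeFn_toLp,
      Lp.coeFn_smul m (contToL2 1),
      ContinuousMap.coeFn_toLp (p := 2) (𝕜 := ℝ) (volume : Measure Torus) (1 : C(Torus, ℝ))]
      with x h1 h2 h3 h4 h5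
    rw [h1, h2, Pi.add_apply, h4, Pi.smul_apply, h5]
    change _ = (hf.memLp (u : L2)).toLp (fun x => f ((u : L2) x) - ⨍ y, f ((u : L2) y)) x + _
    rw [h3]
    simp [hm]
  have h2 : m • contToL2 1 ∈ Hᗮ := by
    refine Submodule.smul_mem _ _ ((Submodule.mem_orthogonal' _ _).2 fun v hv => ?_)
    rw [inner_contToL2]
    simpa using mem_H_iff.1 hv
  rw [h1, map_add, Submodule.orthogonalProjectionOnto_mem_subspace_eq_self,
    Submodule.orthogonalProjectionOnto_apply_of_mem_orthogonal h2, add_zero]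

theorem lipschitzWith_nonlinearity {f : ℝ → ℝ} {K L : ℝ} (hf : Admissible f K L) :
    LipschitzWith L.toNNReal (nonlinearity hf) :=
  LipschitzWith.of_dist_le_mul fun u v => by
    rw [dist_eq_norm, dist_eq_norm, nonlinearity_eq, nonlinearity_eq, ← map_sub,
      Real.coe_toNNReal _ hf.nonneg_right]
    exact (H.norm_orthogonalProjectionOnto_apply_le _).trans (hf.norm_superposition_sub_le _ _)

theorem norm_nonlinearity_le {f : ℝ → ℝ} {K L : ℝ} (hf : Admissible f K L) (u : H) :
    ‖nonlinearity hf u‖ ≤ K * ‖contToL2 1‖ := by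
  rw [nonlinearity_eq]
  exact (H.norm_orthogonalProjectionOnto_apply_le _).trans (hf.norm_superposition_le _)

theorem hasLineDerivAt_nonlinearity {f : ℝ → ℝ} {K L : ℝ} (hf : Admissible f K L) (u v : H) :
    HasLineDerivAt ℝ (nonlinearity hf) (hf.nonlinearityDeriv u v) u v := by
  have h := hf.hasLineDerivAt_superposition u v
  rw [HasLineDerivAt] at h ⊢
  refine (H.orthogonalProjectionOnto.hasFDerivAt.comp_hasDerivAt (0 : ℝ) h).congr_of_eventuallyEq
    (Filter.Eventually.of_forall fun t => ?_)
  exact hf.nonlinearity_eq _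

theorem norm_nonlinearityDeriv_apply_le {f : ℝ → ℝ} {K L : ℝ} (hf : Admissible f K L) (u v : H) :
    ‖hf.nonlinearityDeriv u v‖ ≤ L * ‖v‖ :=
  (H.norm_orthogonalProjectionOnto_apply_le _).trans
    ((hf.superpositionDeriv u).le_of_opNorm_le (norm_mulOp_le _ _ _ _ hf.nonneg_right) (v : L2))

theorem continuous_nonlinearityDeriv_segment {f : ℝ → ℝ} {K L : ℝ} (hf : Admissible f K L)
    (u₁ u₂ v : H) :
    Continuous fun s : ℝ => hf.nonlinearityDeriv (s • u₁ + (1 - s) • u₂) v :=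
  H.orthogonalProjectionOnto.continuous.comp (hf.continuous_superpositionDeriv_segment u₁ u₂ v)

theorem hasMeanValueDerivative {f : ℝ → ℝ} {K L : ℝ} (hf : Admissible f K L) :
    HasMeanValueDerivative (nonlinearity hf) hf.nonlinearityDeriv where
  gateaux := hf.hasLineDerivAt_nonlinearity
  mean_value u₁ u₂ := by
    have hc := hf.continuous_nonlinearityDeriv_segment u₁ u₂
    have hi : ∀ v, IntervalIntegrable
        (fun s : ℝ => hf.nonlinearityDeriv (s • u₁ + (1 - s) • u₂) v) volume 0 1 := fun v =>
      (hc v).intervalIntegrable 0 1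
    let l : H →ₗ[ℝ] H :=
      { toFun := fun v => ∫ s in (0 : ℝ)..1, hf.nonlinearityDeriv (s • u₁ + (1 - s) • u₂) v
        map_add' := fun v w => by
          simp only [map_add]
          exact intervalIntegral.integral_add (hi v) (hi w)
        map_smul' := fun c v => by
          simp only [map_smul, RingHom.id_apply]
          exact intervalIntegral.integral_smul c _ }
    refine ⟨l.mkContinuous L fun v => ?_, fun v => ⟨hi v, rfl⟩, ?_⟩
    · have := intervalIntegral.norm_integral_le_of_norm_le_const (a := 0) (b := 1)
        (f := fun s : ℝ => hf.nonlinearityDeriv (s • u₁ + (1 - s) • u₂) v) (C := L * ‖v‖)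
        fun s _ => hf.norm_nonlinearityDeriv_apply_le _ v
      rwa [sub_zero, abs_one, mul_one] at this
    -- The Gateaux derivative in direction `u₁ - u₂` differentiates `F` along the segment, and the
    -- fundamental theorem of calculus applies.
    · have hd : ∀ s : ℝ, HasDerivAt (fun s : ℝ => nonlinearity hf (s • u₁ + (1 - s) • u₂))
          (hf.nonlinearityDeriv (s • u₁ + (1 - s) • u₂) (u₁ - u₂)) s := fun s => by
        have h := hf.hasLineDerivAt_nonlinearity (s • u₁ + (1 - s) • u₂) (u₁ - u₂)
        rw [HasLineDerivAt] at h
        have h' := HasDerivAt.comp_sub_const (f := fun t : ℝ => nonlinearity hf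
          (s • u₁ + (1 - s) • u₂ + t • (u₁ - u₂))) s s (by rwa [sub_self])
        refine h'.congr_of_eventuallyEq (Filter.Eventually.of_forall fun t => ?_)
        change nonlinearity hf _ = nonlinearity hf _
        congr 1
        module
      have h := intervalIntegral.integral_eq_sub_of_hasDerivAt (fun s _ => hd s) (hi (u₁ - u₂))
      simp only [one_smul, sub_self, zero_smul, add_zero, sub_zero, zero_add] at h
      exact h.symm

end Admissible

/-! ### Spatial averaging -/

theorem exists_trigSpan_of_inner_hartley_eq_zero {Λ : Finset (Fin 3 → ℤ)} {X : H}
    (hX : ∀ l : Freq, (l : Fin 3 → ℤ) ∉ Λ → inner ℝ (hartley l) X = 0) :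
    ∃ g ∈ trigSpan Λ, contToL2 g = X := by
  classical
  let A : Finset Freq := Λ.subtype (fun l => l ≠ 0)
  have hA : ∀ l : Freq, l ∈ A ↔ (l : Fin 3 → ℤ) ∈ Λ := fun l => Finset.mem_subtype
  refine ⟨∑ l ∈ A, (inner ℝ (hartley l) X * casNorm) • cas l, Submodule.sum_mem _ fun l hl =>
    Submodule.smul_mem _ _ (cas_mem_trigSpan ((hA l).1 hl)), ?_⟩
  have h1 : ∑ l ∈ A, (inner ℝ (hartley l) X) • hartley l = X :=
    (hasSum_sum_of_ne_finset_zero fun l hl => by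
      rw [hX l fun h => hl ((hA l).2 h), zero_smul]).unique (hasSum_hartley X)
  have h2 := congrArg H.subtypeL h1
  rw [map_sum] at h2
  simp only [map_smul, Submodule.subtypeL_apply, coe_hartley] at h2
  rw [← h2, map_sum]
  simp only [map_smul, smul_smul]

theorem inner_hartley_smul (l : Freq) (c : ℝ) (u : H) :
    inner ℝ (hartley l) (c • u) = c * inner ℝ (hartley l) u := by
  rw [inner_hartley, inner_hartley, casCoeff_smul, mul_left_comm]

theorem abs_average_le {g : Torus → ℝ} {C : ℝ} (hg : ∀ᵐ x, |g x| ≤ C) : |⨍ x, g x| ≤ C := by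
  have hv := volume_torus_pos
  have h := norm_integral_le_of_norm_le_const (f := g) (by simpa only [Real.norm_eq_abs] using hg)
  rw [Real.norm_eq_abs] at h
  rw [average_torus, smul_eq_mul, abs_mul, abs_of_pos (inv_pos.2 hv), inv_mul_le_iff₀ hv,
    mul_comm _ C]
  exact h

namespace Admissible

theorem integrable_deriv_comp {f : ℝ → ℝ} {K L : ℝ} (hf : Admissible f K L) (u : L2) :
    Integrable fun x => deriv f (u x) :=
  Integrable.of_bound
    (hf.continuous_deriv.comp_aestronglyMeasurable (Lp.aestronglyMeasurable u)) L
    (Filter.Eventually.of_forall fun x => hf.bound_deriv (u x))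

/-- Lipschitz in `u` because `f''` is bounded; this gives the Borel measurability of the multiplier.
-/
theorem continuous_multiplier {f : ℝ → ℝ} {K L : ℝ} (hf : Admissible f K L) :
    Continuous fun u : H => ⨍ x, deriv f ((u : L2) x) := by
  simp only [average_torus]
  suffices h : LipschitzWith (K * ‖contToL2 1‖).toNNReal
      fun u : H => ∫ x, deriv f ((u : L2) x) from
    (continuous_const_smul _).comp h.continuous
  refine LipschitzWith.of_dist_le_mul fun u v => ?_
  rw [Real.coe_toNNReal _ (mul_nonneg hf.nonneg_left (norm_nonneg _)), Real.dist_eq,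
    ← integral_sub (hf.integrable_deriv_comp _) (hf.integrable_deriv_comp _), dist_eq_norm]
  have hi : Integrable fun x => |((u : L2) - v : L2) x| := (integrable_L2 _).abs
  have h1 : ∫ x, |((u : L2) - v : L2) x| ≤ ‖contToL2 1‖ * ‖u - v‖ := by
    have h := real_inner_le_norm (contToL2 1) |((u : L2) - v : L2)|
    rw [inner_contToL2, norm_abs_eq_norm] at h
    refine le_trans (le_of_eq (integral_congr_ae ?_)) h
    filter_upwards [Lp.coeFn_abs ((u : L2) - v : L2)] with x hx
    rw [hx]; simp
  calc |∫ x, (deriv f ((u : L2) x) - deriv f ((v : L2) x))| ≤ ∫ x, K * |((u : L2) - v : L2) x| := by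
        rw [← Real.norm_eq_abs]
        refine norm_integral_le_of_norm_le (hi.const_mul K) ?_
        filter_upwards [Lp.coeFn_sub (u : L2) (v : L2)] with x hx
        have := hf.lipschitzWith_deriv.dist_le_mul ((u : L2) x) ((v : L2) x)
        rw [Real.dist_eq, Real.dist_eq, Real.coe_toNNReal _ hf.nonneg_left] at this
        rwa [hx, Pi.sub_apply]
    _ = K * ∫ x, |((u : L2) - v : L2) x| := integral_const_mul _ _
    _ ≤ K * (‖contToL2 1‖ * ‖u - v‖) := mul_le_mul_of_nonneg_left h1 hf.nonneg_left
    _ = _ := by ring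

/-- On trigonometric polynomials whose frequencies are sparse, multiplication by `f'(u)` acts as
multiplication by its mean value, up to the error of approximation of `f'(u)`. -/
theorem abs_inner_nonlinearityDeriv_sub_le {f : ℝ → ℝ} {K L : ℝ} (hf : Admissible f K L)
    {Λ : Set (Fin 3 → ℤ)} {D : Set (Fin 3 → ℤ)} (hsymm : ∀ a ∈ Λ, -a ∈ Λ)
    (hsep : ∀ a ∈ Λ, ∀ b ∈ Λ, ∀ d ∈ D, d ≠ 0 → a - b ≠ d) {u Y V : H} {y v T : C(Torus, ℝ)}
    (hy : y ∈ trigSpan Λ) (hyY : contToL2 y = Y) (hv : v ∈ trigSpan Λ) (hvV : contToL2 v = V)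
    (hT : T ∈ trigSpan D) {ε : ℝ} (hε : ∀ᵐ x, |deriv f ((u : L2) x) - T x| ≤ ε) :
    |inner ℝ Y (hf.nonlinearityDeriv u V - (⨍ x, deriv f ((u : L2) x)) • V)|
      ≤ 2 * ε * (‖Y‖ * ‖V‖) := by
  set a := ⨍ x, deriv f ((u : L2) x) with ha
  -- `τ` is the mean of `T`, so it differs from `a` by at most `ε`.
  obtain ⟨τ, hτ⟩ := exists_sub_const_mem_trigSpan hT
  have haτ : |a - τ| ≤ ε := by
    have h0 := integral_eq_zero_of_mem_trigSpan (by simp) hτ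
    have h1 : a - τ = ⨍ x, (deriv f ((u : L2) x) - T x) := by
      have h2 : ∫ x, T x = τ * (volume : Measure Torus).real univ := by
        have h3 := integral_sub T.integrable_torus (integrable_const (μ := volume) τ)
        rw [integral_const, smul_eq_mul] at h3
        have h4 : ∫ x, (T x - τ) = 0 := by simpa using h0
        rw [h4] at h3
        linarith
      rw [ha, average_torus, average_torus,
        integral_sub (hf.integrable_deriv_comp _) T.integrable_torus, h2, smul_sub]
      congr 1
      rw [smul_eq_mul, mul_comm, mul_assoc, mul_inv_cancel₀ volume_torus_pos.ne', mul_one]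
    rw [h1]
    exact abs_average_le hε
  have horth : inner ℝ (Y : L2) (contToL2 ((T - τ • 1) * v)) = 0 := by
    rw [← hyY, inner_contToL2]
    have h1 : y * v ∈ trigSpan {e | ∃ a ∈ Λ, ∃ b ∈ Λ, e = a - b} :=
      mul_mem_trigSpan hy hv fun a ha b hb => ⟨⟨a, ha, b, hb, rfl⟩, ⟨b, hb, a, ha, rfl⟩,
        ⟨a, ha, -b, hsymm b hb, by abel⟩, ⟨-a, hsymm a ha, b, hb, rfl⟩⟩
    have hne : ∀ e ∈ {e : Fin 3 → ℤ | ∃ a ∈ Λ, ∃ b ∈ Λ, e = a - b}, ∀ d ∈ D \ {0},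
        e ≠ d ∧ e ≠ -d := by
      rintro e ⟨a, ha, b, hb, rfl⟩ d ⟨hd, hd0⟩
      refine ⟨hsep a ha b hb d hd hd0, fun h => hsep b hb a ha d hd hd0 ?_⟩
      rw [← neg_sub, h, neg_neg]
    -- The frequencies of `y v` are differences of elements of `Λ`, those of `T - τ` are nonzero
    -- elements of `D`; separation keeps frequency zero out of the product, whose integral therefore
    -- vanishes.
    have h2 : (y * v) * (T - τ • 1) ∈ trigSpan {0}ᶜ := by
      refine mul_mem_trigSpan h1 hτ fun e he d hd => ?_
      obtain ⟨h3, h4⟩ := hne e he d hd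
      refine ⟨sub_ne_zero.2 h3, sub_ne_zero.2 h3.symm, fun h => h4 (eq_neg_of_add_eq_zero_left h),
        fun h => h4 (eq_neg_of_add_eq_zero_left (neg_eq_zero.1 ?_))⟩
      rw [neg_add']
      exact h
    refine Eq.trans (integral_congr_ae ?_) (integral_eq_zero_of_mem_trigSpan (by simp) h2)
    filter_upwards [ContinuousMap.coeFn_toLp (p := 2) (𝕜 := ℝ) (volume : Measure Torus)
      ((T - τ • 1) * v)] with x hx
    rw [hx]
    simp only [ContinuousMap.mul_apply]
    ring
  have hE : ‖hf.superpositionDeriv u V - a • (V : L2) - contToL2 ((T - τ • 1) * v)‖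
      ≤ 2 * ε * ‖(V : L2)‖ := by
    refine Lp.norm_le_mul_norm_of_ae_le_mul ?_
    filter_upwards [Lp.coeFn_sub (hf.superpositionDeriv u V - a • (V : L2))
        (contToL2 ((T - τ • 1) * v)), Lp.coeFn_sub (hf.superpositionDeriv u V) (a • (V : L2)),
      Lp.coeFn_smul a (V : L2), hf.coeFn_superpositionDeriv u V,
      ContinuousMap.coeFn_toLp (p := 2) (𝕜 := ℝ) (volume : Measure Torus) ((T - τ • 1) * v),
      ContinuousMap.coeFn_toLp (p := 2) (𝕜 := ℝ) (volume : Measure Torus) v, hε]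
      with x h1 h2 h3 h4 h5 h6 h7
    rw [hvV] at h6
    rw [h1, Pi.sub_apply, h2, Pi.sub_apply, h3, Pi.smul_apply, h4, h5, h6]
    have : deriv f ((u : L2) x) * v x - a • v x - ((T - τ • (1 : C(Torus, ℝ))) * v) x =
        ((deriv f ((u : L2) x) - T x) - (a - τ)) * v x := by
      simp; ring
    rw [this, norm_mul]
    refine mul_le_mul_of_nonneg_right ?_ (norm_nonneg _)
    exact (norm_sub_le _ _).trans (by rw [Real.norm_eq_abs, Real.norm_eq_abs]; linarith)
  have heq : inner ℝ Y (hf.nonlinearityDeriv u V - a • V) =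
      inner ℝ (Y : L2) (hf.superpositionDeriv u V - a • (V : L2) -
        contToL2 ((T - τ • 1) * v)) := by
    -- The projection in the derivative disappears because `Y` already lies in `H`.
    rw [inner_sub_right (Y : L2), horth, sub_zero, inner_sub_right, inner_sub_right]
    congr 1
    exact Submodule.inner_orthogonalProjectionOnto_eq_of_mem_left Y _
  rw [heq]
  calc _ ≤ _ := abs_real_inner_le_norm _ _
    _ ≤ ‖(Y : L2)‖ * (2 * ε * ‖(V : L2)‖) := mul_le_mul_of_nonneg_left hE (norm_nonneg _)
    _ = _ := by rw [Submodule.coe_norm, Submodule.coe_norm]; ring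

end Admissible

namespace LaplaceEigensystem

variable (S : LaplaceEigensystem)

theorem norm_middleProj_le (k : ℝ) (N : ℕ) (v : H) :
    ‖middleProj S.e S.lam k N v‖ ≤ ‖v‖ := by
  refine le_of_sq_le_sq ?_ (norm_nonneg _)
  refine hasSum_le (fun l => ?_) (hasSum_sq_inner_hartley _) (hasSum_sq_inner_hartley v)
  rw [S.inner_hartley_middleProj, mul_pow]
  refine mul_le_of_le_one_left (sq_nonneg _) ?_
  rw [indicator_apply]
  split_ifs <;> simp

theorem inner_middleProj_eq {k : ℝ} {N : ℕ} {Y : H}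
    (hY : ∀ l : Freq, (nsq l : ℝ) ∉ Icc (S.lam N - k) (S.lam N + k) → inner ℝ (hartley l) Y = 0)
    (X : H) : inner ℝ Y (middleProj S.e S.lam k N X) = inner ℝ Y X := by
  rw [← hartleyBasis.tsum_inner_mul_inner, ← hartleyBasis.tsum_inner_mul_inner Y X, coe_hartleyBasis]
  refine tsum_congr fun l => ?_
  rw [S.inner_hartley_middleProj]
  by_cases hl : (nsq l : ℝ) ∈ Icc (S.lam N - k) (S.lam N + k)
  · rw [indicator_of_mem hl, Pi.one_apply, one_mul]
  · rw [real_inner_comm, hY l hl, zero_mul, zero_mul]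

theorem norm_middleProj_sub_le {f : ℝ → ℝ} {K L : ℝ} (hf : Admissible f K L) {k : ℝ} {N : ℕ}
    {D : Set (Fin 3 → ℤ)}
    (hsep : ∀ a b : Fin 3 → ℤ, (nsq a : ℝ) ∈ Icc (S.lam N - k) (S.lam N + k) →
      (nsq b : ℝ) ∈ Icc (S.lam N - k) (S.lam N + k) → ∀ d ∈ D, d ≠ 0 → a - b ≠ d)
    {u : H} {T : C(Torus, ℝ)} (hT : T ∈ trigSpan D) {ε : ℝ}
    (hε : ∀ᵐ x, |deriv f ((u : L2) x) - T x| ≤ ε) (hε0 : 0 ≤ ε) (v : H) :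
    ‖middleProj S.e S.lam k N (hf.nonlinearityDeriv u (middleProj S.e S.lam k N v)) -
      (⨍ x, deriv f ((u : L2) x)) • middleProj S.e S.lam k N v‖ ≤ 2 * ε * ‖v‖ := by
  classical
  set V := middleProj S.e S.lam k N v with hV
  set a := ⨍ x, deriv f ((u : L2) x)
  set Y := middleProj S.e S.lam k N (hf.nonlinearityDeriv u V) - a • V with hY
  let I : Set ℝ := Icc (S.lam N - k) (S.lam N + k)
  have hfin : {l : Fin 3 → ℤ | (nsq l : ℝ) ∈ I}.Finite :=
    (finite_nsq_le ⌊S.lam N + k⌋).subset fun l hl => Int.le_floor.2 hl.2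
  have hmem : ∀ l, l ∈ hfin.toFinset ↔ (nsq l : ℝ) ∈ I := fun l => hfin.mem_toFinset
  have hV0 : ∀ l : Freq, (nsq l : ℝ) ∉ I → inner ℝ (hartley l) V = 0 := fun l hl => by
    rw [hV, S.inner_hartley_middleProj, indicator_of_notMem hl, zero_mul]
  have hY0 : ∀ l : Freq, (nsq l : ℝ) ∉ I → inner ℝ (hartley l) Y = 0 := fun l hl => by
    rw [hY, inner_sub_right, inner_hartley_smul, hV0 l hl, S.inner_hartley_middleProj,
      indicator_of_notMem hl, zero_mul, mul_zero, sub_zero]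
  -- The defect `Y` is itself a trigonometric polynomial on the shell, so the bilinear estimate can
  -- be tested on it, giving `‖Y‖² ≤ 2ε‖Y‖‖V‖`.
  obtain ⟨y, hy, hyY⟩ := exists_trigSpan_of_inner_hartley_eq_zero (Λ := hfin.toFinset) (X := Y)
    fun l hl => hY0 l fun h => hl ((hmem _).2 h)
  obtain ⟨v', hv', hvV⟩ := exists_trigSpan_of_inner_hartley_eq_zero (Λ := hfin.toFinset) (X := V)
    fun l hl => hV0 l fun h => hl ((hmem _).2 h)
  have hmain := hf.abs_inner_nonlinearityDeriv_sub_le (Λ := hfin.toFinset) (D := D)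
    (fun b hb => by
      rw [Finset.mem_coe, hmem] at hb ⊢
      rwa [nsq_neg])
    (fun b hb c hc => hsep b c ((hmem b).1 hb) ((hmem c).1 hc)) hy hyY hv' hvV hT hε
  have hYY : inner ℝ Y (hf.nonlinearityDeriv u V - a • V) = ‖Y‖ ^ 2 := by
    rw [inner_sub_right, ← S.inner_middleProj_eq hY0, ← inner_sub_right,
      real_inner_self_eq_norm_sq]
  rw [hYY, abs_of_nonneg (sq_nonneg _)] at hmain
  have h1 : ‖Y‖ ≤ 2 * ε * ‖V‖ := by
    rcases (norm_nonneg Y).eq_or_lt with h | h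
    · rw [← h]; positivity
    · refine le_of_mul_le_mul_left ?_ h
      linarith
  exact h1.trans (mul_le_mul_of_nonneg_left (S.norm_middleProj_le k N v) (by positivity))

theorem infinite_averaging {f : ℝ → ℝ} {K L : ℝ} (hf : Admissible f K L) {s : ℝ} (hs : 3 / 2 < s)
    {δ : ℝ} (hδ : 0 < δ) (R k : ℝ) :
    {N : ℕ | k < S.lam N ∧ 1 ≤ S.lam (N + 1) - S.lam N ∧
      ∀ u, SobolevNormLE S.e S.lam s R u → ∀ v,
        ‖middleProj S.e S.lam k N (hf.nonlinearityDeriv u (middleProj S.e S.lam k N v))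
          - (⨍ x, deriv f ((u : L2) x)) • middleProj S.e S.lam k N v‖ ≤ δ * ‖v‖}.Infinite := by
  classical
  obtain ⟨D, hD⟩ := exists_trig_approx_comp hs R (half_pos hδ) hf.lipschitzWith_deriv
  refine infinite_of_forall_exists_gt fun n => ?_
  -- The lower bound on `|w|²` secures both `λ_N > k` and `λ_N > λ_n`, the latter forcing `N > n`.
  -- The frequency zero is removed from `D` since it carries the mean.
  obtain ⟨w, hw, hsep⟩ := exists_sparse_shell (D.erase 0) (Finset.notMem_erase 0 D) ⌈k⌉₊
    (max (⌈S.lam n⌉ + 1) (⌈k⌉₊ + 1))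
  have hk := Nat.le_ceil k
  have hw1 : S.lam n < nsq w := by
    have h1 := (le_max_left _ _).trans hw
    have h2 : ((⌈S.lam n⌉ : ℤ) : ℝ) + 1 ≤ nsq w := by exact_mod_cast h1
    have := Int.le_ceil (S.lam n)
    linarith
  have hw2 : k < nsq w := by
    have h1 := (le_max_right _ _).trans hw
    have h2 : (⌈k⌉₊ : ℝ) + 1 ≤ nsq w := by exact_mod_cast h1
    linarith
  have hw0 : w ≠ 0 := by
    rintro rfl
    have := S.lam_pos n
    rw [nsq_eq_zero.2 rfl, Int.cast_zero] at hw1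
    linarith
  obtain ⟨N, hN, hgap⟩ := S.exists_gap ⟨w, hw0⟩
  have hshell : ∀ b : Fin 3 → ℤ, (nsq b : ℝ) ∈ Icc (S.lam N - k) (S.lam N + k) →
      |nsq b - nsq w| ≤ (⌈k⌉₊ : ℤ) := fun b hb => by
    rw [hN] at hb
    have h : |(nsq b : ℝ) - nsq w| ≤ ⌈k⌉₊ := abs_le.2 ⟨by linarith [hb.1], by linarith [hb.2]⟩
    exact_mod_cast h
  refine ⟨N, ⟨by rwa [hN], hgap, fun u hu v => ?_⟩, ?_⟩
  · obtain ⟨U, hU, hUu⟩ := S.exists_of_sobolevNormLE hu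
    obtain ⟨T, hT, hTu⟩ := hD u U hU hUu
    have := S.norm_middleProj_sub_le hf (k := k) (N := N) (D := D)
      (fun b c hb hc d hd hd0 h =>
        hsep b c (hshell b hb) (hshell c hc) (h ▸ Finset.mem_erase.2 ⟨hd0, hd⟩))
      hT hTu (half_pos hδ).le v
    rwa [mul_div_cancel₀ δ two_ne_zero] at this
  · by_contra! h
    have := S.lam_mono h
    rw [hN] at this
    simp only at this
    linarith

end LaplaceEigensystem

end CahnHilliard

end

theorem mainTheorem7 (f : ℝ → ℝ) (K L : ℝ) (hf : CahnHilliard.Admissible f K L) :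
    Nonempty CahnHilliard.LaplaceEigensystem ∧
      ∀ S : CahnHilliard.LaplaceEigensystem, ∀ κ ∈ Set.Ioo (0 : ℝ) (1 / 2),
        CahnHilliard.SpatialAveraging S.e S.lam (CahnHilliard.nonlinearity hf) κ 1
          (fun _ _ _ u => ⨍ x, deriv f ((u : CahnHilliard.L2) x)) := by
  refine ⟨CahnHilliard.nonempty_laplaceEigensystem, fun S κ hκ =>
    { exponent_pos := hκ.1
      gap_pos := one_pos
      bounded := ⟨_, hf.norm_nonlinearity_le⟩
      lipschitz := ⟨_, hf.lipschitzWith_nonlinearity⟩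
      averaging := ⟨hf.nonlinearityDeriv, hf.hasMeanValueDerivative, fun δ hδ R _ k _ => ?_⟩ }⟩
  -- The condition `κ < 1/2` enters exactly here, as `2 - κ > 3/2`.
  refine (S.infinite_averaging hf (s := 2 - κ) (by linarith [hκ.2]) hδ R k).mono
    fun N hN => ⟨hN.1, hN.2.1, ⟨L, fun u => ?_⟩, ?_, hN.2.2⟩
  · exact CahnHilliard.abs_average_le (Filter.Eventually.of_forall fun x => hf.bound_deriv _)
  · let _ : MeasurableSpace CahnHilliard.H := borel CahnHilliard.H
    have : BorelSpace CahnHilliard.H := ⟨rfl⟩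
    exact hf.continuous_multiplier.measurable
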